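/- Conventions. Let $\mathbf K$ be an abstract elementary class with strong-submodel relation $\le_{\mathbf K}$; write $A<_{\mathbf K}B$ for $A\le_{\mathbf K}B$, $A\ne B$, and $\mathbf K_\mu$ for the class of models of cardinality $\mu$. Embeddings are isomorphisms onto a strong submodel of the target. Galois types: for $A\le_{\mathbf K}B$ and $b\in B$, $\mathrm{tp}(b/A;B)$ is the class of $(A,B,b)$ for the equivalence relation generated by: $(A,B,b)\sim(A,C,c)$ iff there are $D\in\mathbf K$ and embeddings $f:B\to D$, $g:C\to D$ with $f\restriction A=g\restriction A$ and $f(b)=g(c)$; $S(A)$ is the collection of types over $A$, $\mathrm{tp}(b/A;B)\restriction A'=\mathrm{tp}(b/A';B)$ for $A'\le_{\mathbf K}A$, and $\mathrm{tp}(b/A;B)$ is non-algebraic if $b\notin A$. A pre-$\lambda$-frame is a triple $\mathfrak s=(\mathbf K,\mathrm{dnf},S^{bs})$ where: $\mathrm{LST}(\mathbf K)\le\lambda$ and $\mathbf K_\lambda\neq\emptyset$; $S^{bs}(A)$ is a set of non-algebraic types over $A$, for each $A\in\mathbf K_\lambda$; $\mathrm{dnf}$ is a relation on quadruples $(A,B,c,C)$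 with $A,B,C\in\mathbf K_\lambda$, $A\le_{\mathbf K}B<_{\mathbf K}C$, $c\in C\setminus B$; $\mathrm{dnf}$ and $S^{bs}$ are invariant under isomorphisms; for $A\le_{\mathbf K}A'\le_{\mathbf K}B'\le_{\mathbf K}B<_{\mathbf K}C'\le_{\mathbf K}C\le_{\mathbf K}C''$ in $\mathbf K_\lambda$ and $c\in C'\setminus B$, $\mathrm{dnf}(A,B,c,C)$ implies $\mathrm{dnf}(A',B',c,C')$ and $\mathrm{dnf}(A',B',c,C'')$; and $\mathrm{dnf}(A,A,c,C)$ implies $\mathrm{tp}(c/A;C)\in S^{bs}(A)$. For $A\le_{\mathbf K}B$ in $\mathbf K_\lambda$, a type $p\in S(B)$ does not fork over $A$ if $p=\mathrm{tp}(c/B;C)$ for some $c,C$ with $\mathrm{dnf}(A,B,c,C)$. The frame satisfies - amalgamation, if any two embeddings $A\to B$, $A\to C$ in $\mathbf K_\lambda$ can be completed to a commutative square of embeddings with some $D\in\mathbf K_\lambda$; - transitivity, if for $A\le_{\mathbf K}B\le_{\mathbf K}C$ in $\mathbf K_\lambda$ and $p\in S(C)$: if $p$ does not fork over $B$ and $p\restriction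 B$ does not fork over $A$, then $p$ does not fork over $A$; - extension, if for $B\le_{\mathbf K}C$ in $\mathbf K_\lambda$ every $p\in S^{bs}(B)$ extends to some $q\in S^{bs}(C)$ that does not fork over $B$; - continuity, if for every nonzero limit $\delta<\lambda^+$, every $\le_{\mathbf K}$-increasing continuous $\langle A_\alpha\mid\alpha\le\delta\rangle$ in $\mathbf K_\lambda$ and every $p\in S(A_\delta)$: if $p\restriction A_\alpha$ does not fork over $A_0$ for all $\alpha<\delta$, then $p\in S^{bs}(A_\delta)$ and $p$ does not fork over $A_0$. For $N$ of cardinality $>\lambda$, $p\in S(N)$ and $A\in\mathbf K_\lambda$ with $A\le_{\mathbf K}N$, $p$ does not fork over $A$ if $p\restriction B$ does not fork over $A$ for every $B\in\mathbf K_\lambda$ with $A\le_{\mathbf K}B\le_{\mathbf K}N$; and $S^{bs}_{>\lambda}(N)$ is the set of $p\in S(N)$ that do not fork over some such $A$. A basic triple is $(A,B,b)$ with $A<_{\mathbf K}B$ in $\mathbf K_\lambda$, $b\in B\setminus A$ and $\mathrm{tp}(b/A;B)\in S^{bs}(A)$. It is a uniqueness triple if there are no $C\in\mathbf K_\lambda$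 with $A<_{\mathbf K}C$, models $D,F\in\mathbf K_\lambda$ with $C\le_{\mathbf K}D$, $C\le_{\mathbf K}F$, and embeddings $f:B\to D$, $g:B\to F$ that are the identity on $A$, such that $\mathrm{tp}(f(b)/C;D)=\mathrm{tp}(g(b)/C;F)$ does not fork over $A$, but there are no $G\in\mathbf K$ and embeddings $h:D\to G$, $k:F\to G$ with $h\circ f=k\circ g$ and $h\restriction C=k\restriction C$. A model $N\in\mathbf K_{\lambda^+}$ is saturated in $\lambda^+$ over $\lambda$ if it realizes every type over every $M\in\mathbf K_\lambda$ with $M<_{\mathbf K}N$. For $N<_{\mathbf K}N'$ in $\mathbf K_{\lambda^+}$, $N'$ is universal over $N$ if every $N^+\in\mathbf K_{\lambda^+}$ with $N\le_{\mathbf K}N^+$ embeds into $N'$ over $N$. A representation of $N\in\mathbf K_{\lambda^+}$ is a $\le_{\mathbf K}$-increasing continuous sequence $\langle A_\alpha\mid\alpha<\lambda^+\rangle$ in $\mathbf K_\lambda$ with union $N$. **Corollary 15.1.** Suppose that 1. $\lambda$ is an infinite cardinal such that $\diamondsuit(\lambda^+)$ holds; 2. $\mathfrak s=(\mathbf K,\mathrm{dnf},S^{bs})$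 is a pre-$\lambda$-frame satisfying amalgamation, transitivity, extension, and continuity; 3. $N^\circ,N^\bullet\in\mathbf K_{\lambda^+}$, $N^\circ$ is saturated in $\lambda^+$ over $\lambda$, $N^\circ<_{\mathbf K}N^\bullet$, and $N^\bullet$ is universal over $N^\circ$; 4. $p\in S^{bs}_{>\lambda}(N^\circ)$. Then there exist a model $N'\in\mathbf K_{\lambda^+}$ with $N^\circ<_{\mathbf K}N'\le_{\mathbf K}N^\bullet$, an element $d\in N'\setminus N^\circ$, and representations $\langle C_\alpha\mid\alpha<\lambda^+\rangle$ of $N^\circ$ and $\langle D_\alpha\mid\alpha<\lambda^+\rangle$ of $N'$ such that 1. $p\restriction C_0=\mathrm{tp}(d/C_0;N')$; 2. both $p$ and $\mathrm{tp}(d/N^\circ;N')$ do not fork over $C_0$; 3. $(C_\alpha,D_\alpha,d)$ is a basic triple for every $\alpha<\lambda^+$; 4. the set of $\alpha<\lambda^+$ such that $(C_\alpha,D_\alpha,d)$ is a uniqueness triple is stationary in $\lambda^+$. -/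

import Mathlib

open FirstOrder

universe u v w

namespace FirstOrder.Language.Substructure

/-- For substructures `A` and `B` of `X`, the part of `A` lying in `B`, as a substructure of `B`;
it is `A` itself, seen inside the structure `B`, when `A ≤ B`. -/
def within {L : FirstOrder.Language.{u, v}} {X : Type w} [L.Structure X]
    (A B : L.Substructure X) : L.Substructure B :=
  A.comap B.subtype.toHom

end FirstOrder.Language.Substructure

open FirstOrder.Language.Substructure (within)

/-- Abstract elementary classes of structures for the vocabulary `L`, with models in `Type w`.
`Mem M` says that `M` belongs to the class; for a substructure `A` of `N`, `Strong A` says that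
`A` is a strong submodel of `N`. -/
structure AEC (L : FirstOrder.Language.{u, v}) where
  Mem : ∀ (M : Type w) [L.Structure M], Prop
  Strong : ∀ {N : Type w} [L.Structure N], L.Substructure N → Prop
  /-- The strong submodel relation is a relation on the class. -/
  strong_dom : ∀ {N : Type w} [L.Structure N] (A : L.Substructure N),
    Strong A → Mem A ∧ Mem N
  mem_iso : ∀ {B C : Type w} [L.Structure B] [L.Structure C], (B ≃[L] C) → Mem B → Mem C
  strong_iso : ∀ {B C : Type w} [L.Structure B] [L.Structure C] (φ : B ≃[L] C)
    (A : L.Substructure B), Strong A → Strong (A.map φ.toHom)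
  strong_refl : ∀ (M : Type w) [L.Structure M], Mem M → Strong (⊤ : L.Substructure M)
  strong_trans : ∀ {C : Type w} [L.Structure C] (A B : L.Substructure C), A ≤ B →
    Strong (within A B) → Strong B → Strong A
  /-- Unions of chains: `M` is the union of the increasing sequence `A α`, `α < δ`. -/
  chain : ∀ {M : Type w} [L.Structure M] (δ : Ordinal.{w}) (A : Ordinal.{w} → L.Substructure M),
    0 < δ →
    (∀ α β, α ≤ β → β < δ → A α ≤ A β ∧ Strong (within (A α) (A β))) →
    (∀ x : M, ∃ α < δ, x ∈ A α) →
    Mem M ∧ ∀ α < δ, Strong (A α)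
  smooth : ∀ {N : Type w} [L.Structure N] (δ : Ordinal.{w}) (A : Ordinal.{w} → L.Substructure N),
    Order.IsSuccLimit δ → Mem N →
    (∀ α β, α ≤ β → β ≤ δ → A α ≤ A β ∧ Strong (within (A α) (A β))) →
    (∀ γ ≤ δ, Order.IsSuccLimit γ → ∀ x ∈ A γ, ∃ α < γ, x ∈ A α) →
    (∀ α < δ, Strong (A α)) → Strong (A δ)
  coherence : ∀ {C : Type w} [L.Structure C] (A B : L.Substructure C), A ≤ B →
    Strong A → Strong B → Strong (within A B)
  /-- Löwenheim–Skolem–Tarski. -/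
  exists_lst : ∃ κ : Cardinal.{w}, Cardinal.aleph0 ≤ κ ∧
    Cardinal.lift.{w} L.card ≤ Cardinal.lift.{max u v} κ ∧
    ∀ (N : Type w) [L.Structure N], Mem N → ∀ Z : Set N,
      ∃ M : L.Substructure N, Strong M ∧ Z ⊆ (M : Set N) ∧
        Cardinal.mk M ≤ max κ (Cardinal.mk Z)

namespace AEC

variable {L : FirstOrder.Language.{u, v}} (K : AEC.{u, v, w} L)

/-- The Löwenheim–Skolem–Tarski number. -/
noncomputable def LST : Cardinal.{w} :=
  sInf {κ : Cardinal.{w} | Cardinal.aleph0 ≤ κ ∧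
    Cardinal.lift.{w} L.card ≤ Cardinal.lift.{max u v} κ ∧
    ∀ (N : Type w) [L.Structure N], K.Mem N → ∀ Z : Set N,
      ∃ M : L.Substructure N, K.Strong M ∧ Z ⊆ (M : Set N) ∧
        Cardinal.mk M ≤ max κ (Cardinal.mk Z)}

/-- `M` is a model of cardinality `μ` in the class. -/
def MemCard (μ : Cardinal.{w}) (M : Type w) [L.Structure M] : Prop :=
  K.Mem M ∧ Cardinal.mk M = μ

/-- The strong submodel relation between two substructures of a common structure. -/
def Le {X : Type w} [L.Structure X] (A B : L.Substructure X) : Prop :=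
  A ≤ B ∧ K.Strong (within A B)

/-- `K`-embeddings: isomorphisms onto a strong submodel. -/
structure Emb (A B : Type w) [L.Structure A] [L.Structure B] where
  map : A ↪[L] B
  strong : K.Strong map.toHom.range

variable {K}

/-- The image of an embedding, as a substructure of the target. -/
def Emb.range {A B : Type w} [L.Structure A] [L.Structure B] (f : K.Emb A B) :
    L.Substructure B :=
  f.map.toHom.range

/-- The inclusion of a strong submodel. -/
def Strong.emb {X : Type w} [L.Structure X] {A : L.Substructure X} (h : K.Strong A) :
    K.Emb A X where
  map := A.subtype
  strong := by rw [FirstOrder.Language.Substructure.range_subtype]; exact h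

/-- The inclusion between two substructures of a common structure, when it is strong. -/
def Le.emb {X : Type w} [L.Structure X] {A B : L.Substructure X} (h : K.Le A B) :
    K.Emb A B where
  map := FirstOrder.Language.Substructure.inclusion h.1
  strong := by
    have : (FirstOrder.Language.Substructure.inclusion h.1).toHom.range = within A B := by
      ext x
      constructor
      · rintro ⟨y, rfl⟩
        exact y.2
      · intro hx
        exact ⟨⟨x.1, hx⟩, rfl⟩
    rw [this]
    exact h.2

/-- Composition of embeddings. -/
def Emb.comp {A B C : Type w} [L.Structure A] [L.Structure B] [L.Structure C]
    (g : K.Emb B C) (f : K.Emb A B) : K.Emb A C where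
  map := g.map.comp f.map
  strong := by
    have h1 := K.strong_iso g.map.equivRange _ f.strong
    refine K.strong_trans _ g.map.toHom.range ?_ ?_ g.strong
    · rintro _ ⟨a, rfl⟩
      exact ⟨f.map a, rfl⟩
    · convert h1
      ext x
      constructor
      · rintro ⟨a, ha⟩
        exact ⟨f.map a, ⟨a, rfl⟩, Subtype.ext ha⟩
      · rintro ⟨_, ⟨a, rfl⟩, rfl⟩
        exact ⟨a, rfl⟩

variable (K)

/-- A pointed extension of `A`: a model containing (a copy of) `A` as a strong submodel, and an
element of it. -/
structure Pointed (A : Type w) [L.Structure A] where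
  B : Type w
  [str : L.Structure B]
  f : K.Emb A B
  b : B

attribute [instance] Pointed.str

/-- Two pointed extensions of `A` can be amalgamated over `A` so that the points get identified. -/
def AtomicEq (A : Type w) [L.Structure A] (P Q : K.Pointed A) : Prop :=
  ∃ (D : Type w) (_ : L.Structure D) (g : K.Emb P.B D) (h : K.Emb Q.B D),
    (∀ a, g.map (P.f.map a) = h.map (Q.f.map a)) ∧ g.map P.b = h.map Q.b

/-- The collection `S(A)` of Galois types over `A`: pointed extensions of `A` modulo the
equivalence relation generated by `AtomicEq`. -/
def GType (A : Type w) [L.Structure A] : Type (max u v (w + 1)) :=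
  Quot (K.AtomicEq A)

variable {K}

/-- The type of `b` over `A` in `B`, where `A` is a strong submodel of `B` via `f`. -/
def tp {A B : Type w} [L.Structure A] [L.Structure B] (f : K.Emb A B) (b : B) : K.GType A :=
  Quot.mk _ ⟨B, f, b⟩

/-- Restriction of types: the restriction of `tp(b/A;B)` along `j : A' → A` is `tp(b/A';B)`. -/
def GType.restrict {A' A : Type w} [L.Structure A'] [L.Structure A] (j : K.Emb A' A) :
    K.GType A → K.GType A' :=
  Quot.map (fun P => ⟨P.B, P.f.comp j, P.b⟩) (by
    rintro P Q ⟨D, _, g, h, hA, hb⟩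
    exact ⟨D, _, g, h, fun a => hA (j.map a), hb⟩)

/-- A type is non-algebraic if it is realized outside of its domain. -/
def GType.IsNonalgebraic {A : Type w} [L.Structure A] (p : K.GType A) : Prop :=
  ∃ (B : Type w) (_ : L.Structure B) (f : K.Emb A B) (b : B), p = tp f b ∧ b ∉ f.range

variable (K)

/-- `N` is full over its strong submodel `A`: it realizes all types over `A`. -/
def IsFullOver {N : Type w} [L.Structure N] (A : L.Substructure N) : Prop :=
  ∃ h : K.Strong A, ∀ p : K.GType A, ∃ b : N, tp (Strong.emb h) b = p

/-- `N` is a model of cardinality `lam⁺` saturated in `lam⁺` over `lam`. -/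
def IsSaturated (lam : Cardinal.{w}) (N : Type w) [L.Structure N] : Prop :=
  K.MemCard (Order.succ lam) N ∧
  ∀ M : L.Substructure N, K.MemCard lam M → K.Strong M → M ≠ ⊤ → K.IsFullOver M

/-- `N'` is universal over its proper strong submodel `N`, both of cardinality `μ`. -/
def IsUniversalOver (μ : Cardinal.{w}) {N' : Type w} [L.Structure N']
    (N : L.Substructure N') : Prop :=
  K.MemCard μ N ∧ K.MemCard μ N' ∧ K.Strong N ∧ N ≠ ⊤ ∧
  ∀ (P : Type w) [L.Structure P], K.MemCard μ P → ∀ g : K.Emb N P,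
    ∃ f : K.Emb P N', ∀ x : N, f.map (g.map x) = (x : N')

/-- `A α`, `α < lam⁺`, is a representation of the substructure `N` of `X`: an increasing
continuous sequence of models of cardinality `lam` with union `N`. -/
structure IsRepresentation (lam : Cardinal.{w}) {X : Type w} [L.Structure X]
    (N : L.Substructure X) (A : Ordinal.{w} → L.Substructure X) : Prop where
  memCard : ∀ α < (Order.succ lam).ord, K.MemCard lam (A α)
  le : ∀ α β, α ≤ β → β < (Order.succ lam).ord → K.Le (A α) (A β)
  continuous : ∀ δ < (Order.succ lam).ord, Order.IsSuccLimit δ →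
    ∀ x, x ∈ A δ ↔ ∃ α < δ, x ∈ A α
  union : ∀ x, x ∈ N ↔ ∃ α < (Order.succ lam).ord, x ∈ A α

end AEC

/-- Pre-`lam`-frames on the class `K`. `bs A` is the set of basic types over `A` (only relevant for
models of cardinality `lam`), and `dnf A B c` is the relation written `dnf(A, B, c, C)` for
substructures `A`, `B` and an element `c` of `C`. -/
structure PreFrame {L : FirstOrder.Language.{u, v}} (K : AEC.{u, v, w} L)
    (lam : Cardinal.{w}) where
  lst_le : K.LST ≤ lam
  exists_model : ∃ (M : Type w) (_ : L.Structure M), K.MemCard lam M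
  bs : ∀ (A : Type w) [L.Structure A], Set (K.GType A)
  bs_nonalgebraic : ∀ (A : Type w) [L.Structure A], K.MemCard lam A →
    ∀ p ∈ bs A, p.IsNonalgebraic
  dnf : ∀ {C : Type w} [L.Structure C], L.Substructure C → L.Substructure C → C → Prop
  dnf_dom : ∀ {C : Type w} [L.Structure C] (A B : L.Substructure C) (c : C), dnf A B c →
    K.MemCard lam A ∧ K.MemCard lam B ∧ K.MemCard lam C ∧ K.Le A B ∧ K.Strong B ∧ c ∉ B
  dnf_iso : ∀ {C C' : Type w} [L.Structure C] [L.Structure C'] (φ : C ≃[L] C')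
    (A B : L.Substructure C) (c : C),
    dnf A B c → dnf (A.map φ.toHom) (B.map φ.toHom) (φ c)
  /-- Invariance of basic types under an isomorphism `φ : C ≃ C'` which induces the isomorphism
  `ψ : B ≃ B'` between strong submodels. -/
  bs_iso : ∀ {B B' C C' : Type w} [L.Structure B] [L.Structure B'] [L.Structure C]
    [L.Structure C'] (f : K.Emb B C) (f' : K.Emb B' C') (ψ : B ≃[L] B') (φ : C ≃[L] C') (c : C),
    K.MemCard lam B → K.MemCard lam C → (∀ x, f'.map (ψ x) = φ (f.map x)) → c ∉ f.range →
    AEC.tp f c ∈ bs B → AEC.tp f' (φ c) ∈ bs B'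
  /-- Monotonicity, for `A ≤ A' ≤ B' ≤ B < C' ≤ C ≤ X`. -/
  dnf_mono : ∀ {X : Type w} [L.Structure X] (A A' B' B C' C : L.Substructure X) (c : X)
    (hc' : c ∈ C') (hc : c ∈ C),
    K.MemCard lam A → K.MemCard lam A' → K.MemCard lam B' → K.MemCard lam B →
    K.MemCard lam C' → K.MemCard lam C → K.MemCard lam X →
    K.Le A A' → K.Le A' B' → K.Le B' B → K.Le B C' → K.Le C' C → K.Strong C → c ∉ B →
    dnf (within A C) (within B C) ⟨c, hc⟩ →
    dnf (within A' C') (within B' C') ⟨c, hc'⟩ ∧ dnf A' B' c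
  dnf_basic : ∀ {C : Type w} [L.Structure C] (A : L.Substructure C) (c : C) (h : K.Strong A),
    dnf A A c → AEC.tp (AEC.Strong.emb h) c ∈ bs A

namespace PreFrame

variable {L : FirstOrder.Language.{u, v}} {K : AEC.{u, v, w} L} {lam : Cardinal.{w}}
  (s : PreFrame K lam)

/-- The type `p` over the model `B` (of cardinality `lam`) does not fork over the submodel `A`. -/
def DoesNotFork {B : Type w} [L.Structure B] (p : K.GType B) (A : L.Substructure B) : Prop :=
  ∃ (C : Type w) (_ : L.Structure C) (f : K.Emb B C) (c : C),
    p = AEC.tp f c ∧ s.dnf (A.map f.map.toHom) f.range c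

/-- The type `p` over the model `N` (of cardinality `> lam`) does not fork over its strong
submodel `A` of cardinality `lam`. -/
def BigDoesNotFork {N : Type w} [L.Structure N] (p : K.GType N) (A : L.Substructure N) : Prop :=
  K.MemCard lam A ∧ K.Strong A ∧
  ∀ (B : L.Substructure N) (hB : K.Strong B), K.MemCard lam B → K.Le A B →
    s.DoesNotFork (p.restrict (AEC.Strong.emb hB)) (within A B)

/-- The set of basic types over a model `N` of cardinality `> lam`. -/
def bigBs (N : Type w) [L.Structure N] : Set (K.GType N) :=
  {p | ∃ A : L.Substructure N, s.BigDoesNotFork p A}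

/-- The amalgamation property in cardinality `lam`. -/
def Amalgamation (_s : PreFrame K lam) : Prop :=
  ∀ (A B C : Type w) [L.Structure A] [L.Structure B] [L.Structure C],
    K.MemCard lam A → K.MemCard lam B → K.MemCard lam C →
    ∀ (gB : K.Emb A B) (gC : K.Emb A C),
      ∃ (D : Type w) (_ : L.Structure D) (fB : K.Emb B D) (fC : K.Emb C D),
        K.MemCard lam D ∧ ∀ a, fB.map (gB.map a) = fC.map (gC.map a)

def Transitivity : Prop :=
  ∀ (C : Type w) [L.Structure C] (A B : L.Substructure C) (_ : K.Le A B) (hB : K.Strong B),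
    K.MemCard lam A → K.MemCard lam B → K.MemCard lam C →
    ∀ p : K.GType C, s.DoesNotFork p B →
      s.DoesNotFork (p.restrict (AEC.Strong.emb hB)) (within A B) → s.DoesNotFork p A

def Extension : Prop :=
  ∀ (C : Type w) [L.Structure C] (B : L.Substructure C) (hB : K.Strong B),
    K.MemCard lam B → K.MemCard lam C →
    ∀ p ∈ s.bs B, ∃ q ∈ s.bs C, q.restrict (AEC.Strong.emb hB) = p ∧ s.DoesNotFork q B

/-- Continuity, for the increasing continuous sequence `A α`, `α < δ`, with union `M`. -/
def Continuity : Prop :=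
  ∀ (δ : Ordinal.{w}), Order.IsSuccLimit δ → δ < (Order.succ lam).ord →
    ∀ (M : Type w) [L.Structure M] (A : Ordinal.{w} → L.Substructure M),
      K.MemCard lam M →
      (∀ α < δ, K.MemCard lam (A α)) →
      (∀ α β, α ≤ β → β < δ → K.Le (A α) (A β)) →
      ∀ hA : ∀ α < δ, K.Strong (A α),
      (∀ γ < δ, Order.IsSuccLimit γ → ∀ x, x ∈ A γ ↔ ∃ α < γ, x ∈ A α) →
      (∀ x : M, ∃ α < δ, x ∈ A α) →
      ∀ p : K.GType M,
        (∀ (α : Ordinal.{w}) (hα : α < δ),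
          s.DoesNotFork (p.restrict (AEC.Strong.emb (hA α hα))) (within (A 0) (A α))) →
        p ∈ s.bs M ∧ s.DoesNotFork p (A 0)

/-- `(A, B, b)` is a basic triple. -/
def IsBasicTriple {B : Type w} [L.Structure B] (A : L.Substructure B) (b : B) : Prop :=
  K.MemCard lam A ∧ K.MemCard lam B ∧ b ∉ A ∧
    ∃ h : K.Strong A, AEC.tp (AEC.Strong.emb h) b ∈ s.bs A

/-- The extension `j : A → C` of `A` (with `C` a proper extension) witnesses the non-uniqueness of
`(A, B, b)`: there are two amalgamations `D` and `F` of `B` and `C` over `A`, in cardinality `lam`,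
which are not equivalent over `A`, such that the images of `b` have the same type over `C`, and
this type does not fork over `A`. -/
def WitnessesNonUniqueness {B : Type w} [L.Structure B] {A : L.Substructure B}
    (hA : K.Strong A) (b : B) {C : Type w} [L.Structure C] (j : K.Emb A C) : Prop :=
  K.MemCard lam C ∧ j.range ≠ ⊤ ∧
  ∃ (D : Type w) (_ : L.Structure D) (F : Type w) (_ : L.Structure F)
    (fB : K.Emb B D) (fC : K.Emb C D) (gB : K.Emb B F) (gC : K.Emb C F),
    K.MemCard lam D ∧ K.MemCard lam F ∧
    (∀ a, fB.map ((AEC.Strong.emb hA).map a) = fC.map (j.map a)) ∧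
    (∀ a, gB.map ((AEC.Strong.emb hA).map a) = gC.map (j.map a)) ∧
    (¬ ∃ (G : Type w) (_ : L.Structure G) (hD : K.Emb D G) (hF : K.Emb F G),
      (∀ x, hD.map (fB.map x) = hF.map (gB.map x)) ∧
      (∀ x, hD.map (fC.map x) = hF.map (gC.map x))) ∧
    AEC.tp fC (fB.map b) = AEC.tp gC (gB.map b) ∧
    s.DoesNotFork (AEC.tp fC (fB.map b)) j.range

/-- `(A, B, b)` is a uniqueness triple. -/
def IsUniquenessTriple {B : Type w} [L.Structure B] (A : L.Substructure B) (b : B) : Prop :=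
  s.IsBasicTriple A b ∧
    ∀ (hA : K.Strong A) (C : Type w) [L.Structure C] (j : K.Emb A C),
      ¬ s.WitnessesNonUniqueness hA b j

end PreFrame

/-- Jensen's diamond principle at the cardinal `κ`. -/
def Diamond (κ : Cardinal.{w}) : Prop :=
  ∃ S : Ordinal.{w} → Set Ordinal.{w},
    (∀ α < κ.ord, S α ⊆ Set.Iio α) ∧
    ∀ X ⊆ Set.Iio κ.ord,
      IsStationary {α : Set.Iio κ.ord | X ∩ Set.Iio (α : Ordinal.{w}) = S α}

/-! An extension of `N^∘` by a point `b` is built as the union of a continuous chain of `λ⁺`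
approximations. Each consists of a strong submodel of `N^∘` of size `λ`, a target of size `λ` whose
carrier lies in a fixed set of size `λ⁺`, and an embedding of the former into the latter; the type
of `b` over the submodel does not fork over a fixed `A₀`. Amalgamation, extension and transitivity
let the domain grow, and continuity carries non-forking through limits, so all of `N^∘` is
exhausted. Universality embeds the union into `N^•` over `N^∘` by some `h`. The image of `h` is
`N'`, the image of `b` is `d`, and the images of the stages give both representations.

Diamond produces the uniqueness triples. The guess at a stage may be the graph of an embedding `k`
of the current target into `N^•`. If the current triple is not a uniqueness triple, the target has
two inequivalent amalgams with some `C` over the current domain. Saturated models are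
model-homogeneous, so `C` may be placed inside `N^∘`. An extension of `k` over `N^∘` to either
amalgam is then forced on both factors: it is `k` on the target and the inclusion on `C`. If both
amalgams had such extensions, they would be amalgamated inside `N^•`, against inequivalence. Hence
one of them is a next approximation to which `k` does not extend.

But the restriction of `h` to any stage does extend to the next one. So wherever that restriction
was guessed, the triple is a uniqueness triple, and such stages are stationary because the codes of
`h` match the stages on a club. The main lemmas are `IsSaturated.exists_emb`, `IsApprox.of_isUnion`,
`IsApprox.exists_extends_of_not_uniqueness`, `exists_continuous_chain` and `isClub_coded`. -/

namespace AEC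

variable {L : FirstOrder.Language.{u, v}} {K : AEC.{u, v, w} L}

/-! ### Embeddings, their ranges and factorizations -/

section Embeddings

variable {A B C D : Type w} [L.Structure A] [L.Structure B] [L.Structure C] [L.Structure D]

theorem Emb.ext {f g : K.Emb A B} (h : ∀ x, f.map x = g.map x) : f = g := by
  cases f
  cases g
  congr 1
  exact FirstOrder.Language.Embedding.ext h

theorem Emb.injective (f : K.Emb A B) : Function.Injective f.map := f.map.injective

@[simp]
theorem Emb.comp_apply (g : K.Emb B C) (f : K.Emb A B) (a : A) :
    (g.comp f).map a = g.map (f.map a) := rfl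

@[simp]
theorem Strong.emb_apply {X : Type w} [L.Structure X] {A : L.Substructure X} (h : K.Strong A)
    (a : A) : (Strong.emb h).map a = a := rfl

@[simp]
theorem Le.emb_apply {X : Type w} [L.Structure X] {A B : L.Substructure X} (h : K.Le A B)
    (a : A) : ((Le.emb h).map a : X) = a := rfl

theorem Emb.range_comp (g : K.Emb B C) (f : K.Emb A B) :
    (g.comp f).range = f.range.map g.map.toHom := by
  ext x
  constructor
  · rintro ⟨a, rfl⟩
    exact ⟨f.map a, ⟨a, rfl⟩, rfl⟩
  · rintro ⟨_, ⟨a, rfl⟩, rfl⟩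
    exact ⟨a, rfl⟩

theorem Strong.range_emb {X : Type w} [L.Structure X] {A : L.Substructure X} (h : K.Strong A) :
    (Strong.emb h).range = A :=
  FirstOrder.Language.Substructure.range_subtype A

theorem Le.range_emb {X : Type w} [L.Structure X] {A B : L.Substructure X} (h : K.Le A B) :
    (Le.emb h).range = within A B := by
  ext x
  constructor
  · rintro ⟨y, rfl⟩
    exact y.2
  · intro hx
    exact ⟨⟨x.1, hx⟩, rfl⟩

theorem Emb.mem_right (f : K.Emb A B) : K.Mem B := (K.strong_dom _ f.strong).2

theorem Emb.mem_left (f : K.Emb A B) : K.Mem A :=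
  K.mem_iso f.map.equivRange.symm (K.strong_dom _ f.strong).1

/-- An isomorphism between models as an embedding. -/
def Emb.ofEquiv (e : A ≃[L] B) (h : K.Mem B) : K.Emb A B where
  map := e.toEmbedding
  strong := by
    have : e.toEmbedding.toHom.range = ⊤ := by
      rw [FirstOrder.Language.Equiv.toEmbedding_toHom, FirstOrder.Language.Equiv.toHom_range]
    rw [this]
    exact K.strong_refl B h

@[simp]
theorem Emb.ofEquiv_apply (e : A ≃[L] B) (h : K.Mem B) (a : A) :
    (Emb.ofEquiv e h).map a = e a := rfl

/-- The corestriction of an embedding to its range. -/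
noncomputable def Emb.toRange (f : K.Emb A B) : A ≃[L] f.range := f.map.equivRange

theorem Emb.strong_range (f : K.Emb A B) : K.Strong f.range := f.strong

/-- If `g` is an embedding of structures and `f` is a `K`-embedding, then `g (f A)` is strong
in `g B`. -/
theorem strong_within_range (f : K.Emb A B) (g : B ↪[L] C) (h : A ↪[L] C)
    (hgf : ∀ a, g (f.map a) = h a) : K.Strong (within h.toHom.range g.toHom.range) := by
  convert K.strong_iso g.equivRange _ f.strong
  ext x
  constructor
  · rintro ⟨a, ha⟩
    exact ⟨f.map a, ⟨a, rfl⟩, Subtype.ext ((hgf a).trans ha)⟩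
  · rintro ⟨_, ⟨a, rfl⟩, rfl⟩
    exact ⟨a, (hgf a).symm⟩

/-- Embeddings into a common target factor through each other when their ranges are nested. -/
theorem Emb.exists_lift (f : K.Emb A C) (g : K.Emb B C) (h : f.range ≤ g.range) :
    ∃ k : K.Emb A B, ∀ a, g.map (k.map a) = f.map a := by
  have hs := K.coherence _ _ h f.strong g.strong
  let i : f.range ↪[L] g.range := FirstOrder.Language.Substructure.inclusion h
  let k : A ↪[L] B := g.toRange.symm.toEmbedding.comp (i.comp f.toRange.toEmbedding)
  have hk : ∀ a, g.map (k a) = f.map a := by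
    intro a
    have h1 : g.toRange (k a) = i (f.toRange a) := g.toRange.apply_symm_apply _
    exact congrArg Subtype.val h1
  refine ⟨⟨k, ?_⟩, hk⟩
  convert K.strong_iso g.toRange.symm _ hs
  ext x
  constructor
  · rintro ⟨a, rfl⟩
    exact ⟨i (f.toRange a), ⟨a, rfl⟩, rfl⟩
  · rintro ⟨⟨_, _⟩, ⟨a, rfl⟩, rfl⟩
    refine ⟨a, g.injective ?_⟩
    refine (hk a).trans ?_
    exact (congrArg Subtype.val (g.toRange.apply_symm_apply ⟨f.map a, h ⟨a, rfl⟩⟩)).symm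

theorem le_of_strong {X : Type w} [L.Structure X] {A B : L.Substructure X} (hAB : A ≤ B)
    (hA : K.Strong A) (hB : K.Strong B) : K.Le A B :=
  ⟨hAB, K.coherence A B hAB hA hB⟩

theorem Le.strong {X : Type w} [L.Structure X] {A B : L.Substructure X} (h : K.Le A B)
    (hB : K.Strong B) : K.Strong A :=
  K.strong_trans A B h.1 h.2 hB

theorem MemCard.of_equiv {μ : Cardinal.{w}} (h : K.MemCard μ A) (e : A ≃[L] B) : K.MemCard μ B :=
  ⟨K.mem_iso e h.1, (Cardinal.mk_congr e.toEquiv).symm.trans h.2⟩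

theorem MemCard.range {μ : Cardinal.{w}} (h : K.MemCard μ A) (f : K.Emb A B) :
    K.MemCard μ f.range :=
  h.of_equiv f.toRange

theorem Strong.memCard {X : Type w} [L.Structure X] {A : L.Substructure X} {μ : Cardinal.{w}}
    (h : K.Strong A) (hA : Cardinal.mk A = μ) : K.MemCard μ A :=
  ⟨(K.strong_dom A h).1, hA⟩

end Embeddings

/-! ### Löwenheim–Skolem in cardinality `lam` -/

theorem exists_strong_of_LST {lam : Cardinal.{w}} (hL : K.LST ≤ lam) {N : Type w} [L.Structure N]
    (hN : K.Mem N) (Z : Set N) (hZ : Cardinal.mk Z = lam) :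
    ∃ M : L.Substructure N, K.Strong M ∧ Z ⊆ (M : Set N) ∧ K.MemCard lam M := by
  obtain ⟨-, -, h⟩ := csInf_mem K.exists_lst
  obtain ⟨M, hM, hZM, hc⟩ := h N hN Z
  refine ⟨M, hM, hZM, hM.memCard (le_antisymm ?_ ?_)⟩
  · refine hc.trans (max_le hL hZ.le)
  · rw [← hZ]
    exact Cardinal.mk_le_mk_of_subset hZM

theorem mk_range_union_range {lam : Cardinal.{w}} (hlam : Cardinal.aleph0 ≤ lam)
    {A B N : Type w} {f : A → N} (g : B → N) (hf : Function.Injective f)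
    (hA : Cardinal.mk A = lam) (hB : Cardinal.mk B ≤ lam) :
    Cardinal.mk ↥(Set.range f ∪ Set.range g) = lam := by
  apply le_antisymm
  · refine (Cardinal.mk_union_le _ _).trans ?_
    refine (add_le_add (Cardinal.mk_range_le.trans hA.le) (Cardinal.mk_range_le.trans hB)).trans ?_
    rw [Cardinal.add_eq_self hlam]
  · rw [← hA, ← Cardinal.mk_range_eq f hf]
    exact Cardinal.mk_le_mk_of_subset Set.subset_union_left

/-- Löwenheim–Skolem–Tarski: a model of size `lam` embedded in `N`, and `lam` further points of
`N`, are contained in a strong submodel of size `lam`. -/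
theorem exists_emb_of_LST {lam : Cardinal.{w}} (hlam : Cardinal.aleph0 ≤ lam) (hL : K.LST ≤ lam)
    {A N : Type w} [L.Structure A] [L.Structure N] (hA : K.MemCard lam A) (f : K.Emb A N)
    {B : Type w} (g : B → N) (hB : Cardinal.mk B ≤ lam) :
    ∃ M : L.Substructure N, K.Strong M ∧ K.MemCard lam M ∧ f.range ≤ M ∧ ∀ b, g b ∈ M := by
  obtain ⟨M, h1, h2, h3⟩ := exists_strong_of_LST hL f.mem_right _
    (mk_range_union_range hlam g f.injective hA.2 hB)
  refine ⟨M, h1, h3, ?_, fun b => h2 (Or.inr ⟨b, rfl⟩)⟩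
  rintro _ ⟨a, rfl⟩
  exact h2 (Or.inl ⟨a, rfl⟩)

/-! ### Galois types -/

section Types

variable {A B C D : Type w} [L.Structure A] [L.Structure B] [L.Structure C] [L.Structure D]

theorem tp_eq_of_amalgam {f : K.Emb A B} {b : B} {g : K.Emb A C} {c : C} (h : K.Emb B D)
    (k : K.Emb C D) (hA : ∀ a, h.map (f.map a) = k.map (g.map a)) (hb : h.map b = k.map c) :
    tp f b = tp g c :=
  Quot.sound ⟨D, _, h, k, hA, hb⟩

theorem tp_comp (f : K.Emb A B) (b : B) (h : K.Emb B D) : tp (h.comp f) (h.map b) = tp f b :=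
  tp_eq_of_amalgam (Emb.ofEquiv (FirstOrder.Language.Equiv.refl L D) h.mem_right) h
    (fun _ => rfl) rfl

theorem tp_eq_of_emb {f : K.Emb A B} {b : B} {g : K.Emb A C} {c : C} (h : K.Emb B C)
    (hA : ∀ a, h.map (f.map a) = g.map a) (hb : h.map b = c) : tp f b = tp g c := by
  rw [← tp_comp f b h, hb, show h.comp f = g from Emb.ext hA]

@[simp]
theorem restrict_tp (f : K.Emb B C) (c : C) (j : K.Emb A B) :
    (tp f c).restrict j = tp (f.comp j) c := rfl

theorem restrict_restrict (p : K.GType C) (j : K.Emb B C) (i : K.Emb A B) :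
    (p.restrict j).restrict i = p.restrict (j.comp i) := by
  induction p using Quot.ind
  rfl

theorem exists_tp (p : K.GType A) :
    ∃ (B : Type w) (_ : L.Structure B) (f : K.Emb A B) (b : B), p = tp f b := by
  induction p using Quot.ind with
  | mk P => exact ⟨P.B, P.str, P.f, P.b, rfl⟩

/-- Algebraicity of a point over `A` depends only on its type. -/
theorem mem_range_iff_of_tp_eq {f : K.Emb A B} {b : B} {g : K.Emb A C} {c : C}
    (h : tp f b = tp g c) (a : A) : f.map a = b ↔ g.map a = c := by
  let R : K.Pointed A → K.Pointed A → Prop := fun P Q => P.f.map a = P.b ↔ Q.f.map a = Q.b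
  have hR : ∀ P Q, Relation.EqvGen (K.AtomicEq A) P Q → R P Q := by
    intro P Q hPQ
    induction hPQ with
    | rel P Q hPQ =>
      obtain ⟨D, _, g, h, hA, hb⟩ := hPQ
      constructor
      · intro hP
        apply h.injective
        rw [← hA, ← hb, hP]
      · intro hQ
        apply g.injective
        rw [hA, hb, hQ]
    | refl P => exact Iff.rfl
    | symm P Q _ ih => exact ih.symm
    | trans P Q S _ _ ih1 ih2 => exact ih1.trans ih2
  exact hR ⟨B, f, b⟩ ⟨C, g, c⟩ (Quot.eqvGen_exact h)

end Types

end AEC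

/-! ### Amalgamation realizing an equality of types -/

namespace PreFrame

open AEC

variable {L : FirstOrder.Language.{u, v}} {K : AEC.{u, v, w} L} {lam : Cardinal.{w}}
  {s : PreFrame K lam}
variable {A B C D : Type w} [L.Structure A] [L.Structure B] [L.Structure C] [L.Structure D]

/-- Under amalgamation in `lam`, equal types over a model of size `lam`, realized in models of size
`lam`, can be amalgamated in `lam` identifying the realizations. -/
theorem Amalgamation.exists_of_tp_eq (hlam : Cardinal.aleph0 ≤ lam) (hAP : s.Amalgamation)
    (hA : K.MemCard lam A) (hB : K.MemCard lam B) (hC : K.MemCard lam C)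
    {f : K.Emb A B} {b : B} {g : K.Emb A C} {c : C} (h : tp f b = tp g c) :
    ∃ (D : Type w) (_ : L.Structure D) (fB : K.Emb B D) (fC : K.Emb C D), K.MemCard lam D ∧
      (∀ a, fB.map (f.map a) = fC.map (g.map a)) ∧ fB.map b = fC.map c := by
  -- The generated equivalence may pass through models of any size, so the claim proved by induction
  -- concerns all models of size `lam` that embed into `P` and `Q` over `A` with the point
  -- preserved.
  let R : K.Pointed A → K.Pointed A → Prop := fun P Q =>
    ∀ P₀ Q₀ : K.Pointed A, K.MemCard lam P₀.B → K.MemCard lam Q₀.B →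
      (∃ i : K.Emb P₀.B P.B, (∀ a, i.map (P₀.f.map a) = P.f.map a) ∧ i.map P₀.b = P.b) →
      (∃ i : K.Emb Q₀.B Q.B, (∀ a, i.map (Q₀.f.map a) = Q.f.map a) ∧ i.map Q₀.b = Q.b) →
      ∃ (D : Type w) (_ : L.Structure D) (f : K.Emb P₀.B D) (g : K.Emb Q₀.B D), K.MemCard lam D ∧
        (∀ a, f.map (P₀.f.map a) = g.map (Q₀.f.map a)) ∧ f.map P₀.b = g.map Q₀.b
  have hrel : ∀ P Q, K.AtomicEq A P Q → R P Q := by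
    rintro P Q ⟨D, _, g, h, hgh, hb⟩ P₀ Q₀ hP₀ hQ₀ ⟨i, hi, hib⟩ ⟨j, hj, hjb⟩
    obtain ⟨M, hM, hMc, hle, hmem⟩ := exists_emb_of_LST hlam s.lst_le hP₀ (g.comp i)
      (h.comp j).map hQ₀.2.le
    obtain ⟨f', hf'⟩ := Emb.exists_lift (g.comp i) (Strong.emb hM) (by rwa [hM.range_emb])
    obtain ⟨g', hg'⟩ := Emb.exists_lift (h.comp j) (Strong.emb hM) (by
      rw [hM.range_emb]
      rintro _ ⟨x, rfl⟩
      exact hmem x)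
    refine ⟨M, inferInstance, f', g', hMc, fun a => ?_, ?_⟩
    · apply (Strong.emb hM).injective
      rw [hf', hg', Emb.comp_apply, Emb.comp_apply, hi, hj, hgh]
    · apply (Strong.emb hM).injective
      rw [hf', hg', Emb.comp_apply, Emb.comp_apply, hib, hjb, hb]
  have hR : ∀ P Q, Relation.EqvGen (K.AtomicEq A) P Q → R P Q := by
    intro P Q hPQ
    induction hPQ with
    | rel P Q hPQ => exact hrel P Q hPQ
    | refl P =>
      refine hrel P P ?_
      let i : K.Emb P.B P.B :=
        Emb.ofEquiv (FirstOrder.Language.Equiv.refl L P.B) P.f.mem_right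
      exact ⟨P.B, P.str, i, i, fun _ => rfl, rfl⟩
    | symm P Q _ ih =>
      intro P₀ Q₀ hP₀ hQ₀ hi hj
      obtain ⟨D, _, f, g, hD, h1, h2⟩ := ih Q₀ P₀ hQ₀ hP₀ hj hi
      exact ⟨D, _, g, f, hD, fun a => (h1 a).symm, h2.symm⟩
    | trans P Q S _ _ ih1 ih2 =>
      intro P₀ S₀ hP₀ hS₀ hi hj
      -- The intermediate model `Q` may be large. A submodel of size `lam` containing `A` and its
      -- point serves as the common base over which the two amalgams are amalgamated.
      obtain ⟨M, hM, hMc, hle, hmem⟩ := exists_emb_of_LST hlam s.lst_le hA Q.f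
        (fun _ : PUnit.{w + 1} => Q.b) (by
          rw [Cardinal.mk_punit]
          exact Cardinal.one_le_aleph0.trans hlam)
      obtain ⟨f', hf'⟩ := Emb.exists_lift Q.f (Strong.emb hM) (by rwa [hM.range_emb])
      let Q₀ : K.Pointed A := ⟨M, f', ⟨Q.b, hmem ⟨⟩⟩⟩
      have hk : ∃ i : K.Emb Q₀.B Q.B, (∀ a, i.map (Q₀.f.map a) = Q.f.map a) ∧ i.map Q₀.b = Q.b :=
        ⟨Strong.emb hM, hf', rfl⟩
      obtain ⟨D₁, _, f₁, g₁, hD₁, h₁, h₁'⟩ := ih1 P₀ Q₀ hP₀ hMc hi hk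
      obtain ⟨D₂, _, f₂, g₂, hD₂, h₂, h₂'⟩ := ih2 Q₀ S₀ hMc hS₀ hk hj
      obtain ⟨E, _, k₁, k₂, hE, hk⟩ := hAP _ _ _ hMc hD₁ hD₂ g₁ f₂
      refine ⟨E, _, k₁.comp f₁, k₂.comp g₂, hE, fun a => ?_, ?_⟩
      · rw [Emb.comp_apply, Emb.comp_apply, h₁, ← h₂]
        exact hk _
      · rw [Emb.comp_apply, Emb.comp_apply, h₁', ← h₂']
        exact hk _
  have hid : ∀ P : K.Pointed A,
      ∃ i : K.Emb P.B P.B, (∀ a, i.map (P.f.map a) = P.f.map a) ∧ i.map P.b = P.b := fun P =>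
    ⟨Emb.ofEquiv (FirstOrder.Language.Equiv.refl L P.B) P.f.mem_right, fun _ => rfl, rfl⟩
  exact hR ⟨B, f, b⟩ ⟨C, g, c⟩ (Quot.eqvGen_exact h) ⟨B, f, b⟩ ⟨C, g, c⟩ hB hC (hid _) (hid _)

end PreFrame

/-! ### Non-forking along embeddings -/

namespace PreFrame

open AEC

variable {L : FirstOrder.Language.{u, v}} {K : AEC.{u, v, w} L} {lam : Cardinal.{w}}
  {s : PreFrame K lam}
variable {A A' B' B C D : Type w} [L.Structure A] [L.Structure A'] [L.Structure B']
  [L.Structure B] [L.Structure C] [L.Structure D]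

/-- The monotonicity axiom with `C' = C = X`. The axiom places its hypothesis inside a substructure,
so `X` is first replaced by its isomorphic copy `⊤`. -/
theorem dnf_of_le {X : Type w} [L.Structure X] {A A' B' B : L.Substructure X} {c : X}
    (h : s.dnf A B c) (hA' : K.MemCard lam A') (hB' : K.MemCard lam B') (hAA' : K.Le A A')
    (hAB' : K.Le A' B') (hBB' : K.Le B' B) : s.dnf A' B' c := by
  obtain ⟨h1, h2, h3, h4, h5, h6⟩ := s.dnf_dom A B c h
  have ht : K.Strong (⊤ : L.Substructure X) := K.strong_refl X h3.1
  have htc : K.MemCard lam (⊤ : L.Substructure X) :=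
    h3.of_equiv FirstOrder.Language.Substructure.topEquiv.symm
  have hmap : ∀ A : L.Substructure X,
      A.map (FirstOrder.Language.Substructure.topEquiv (L := L) (M := X)).symm.toHom =
        within A ⊤ := by
    intro A
    ext x
    constructor
    · rintro ⟨a, ha, rfl⟩
      exact ha
    · intro hx
      exact ⟨x.1, hx, rfl⟩
  have := s.dnf_iso (FirstOrder.Language.Substructure.topEquiv (L := L) (M := X)).symm A B c h
  rw [hmap, hmap] at this
  refine (s.dnf_mono A A' B' B ⊤ ⊤ c trivial trivial h1 hA' hB' h2 htc htc h3 hAA' hAB' hBB'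
    (le_of_strong le_top h5 ht) (le_of_strong le_rfl ht ht) ht h6 this).2

variable (s) in
/-- The type `p` does not fork over the model embedded by `i` in its domain. -/
def NonforkingOver (i : K.Emb A B) (p : K.GType B) : Prop :=
  s.DoesNotFork p i.range

theorem nonforkingOver_iff {i : K.Emb A B} {p : K.GType B} :
    s.NonforkingOver i p ↔ ∃ (C : Type w) (_ : L.Structure C) (f : K.Emb B C) (c : C),
      p = tp f c ∧ s.dnf (f.comp i).range f.range c := by
  unfold NonforkingOver DoesNotFork
  simp only [Emb.range_comp]

theorem range_comp_le (f : K.Emb B C) (i : K.Emb A B) : (f.comp i).range ≤ f.range := by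
  rintro _ ⟨a, rfl⟩
  exact ⟨i.map a, rfl⟩

theorem le_range_comp (f : K.Emb B C) (i : K.Emb A B) : K.Le (f.comp i).range f.range :=
  le_of_strong (range_comp_le f i) (f.comp i).strong f.strong

theorem NonforkingOver.mono {i : K.Emb A A'} {j : K.Emb A' B'} {k : K.Emb B' B} {p : K.GType B}
    (h : s.NonforkingOver ((k.comp j).comp i) p) (hA' : K.MemCard lam A')
    (hB' : K.MemCard lam B') : s.NonforkingOver j (p.restrict k) := by
  obtain ⟨C, _, f, c, rfl, hd⟩ := nonforkingOver_iff.1 h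
  refine nonforkingOver_iff.2 ⟨C, _, f.comp k, c, rfl, ?_⟩
  exact dnf_of_le hd (hA'.range _) (hB'.range _) (le_range_comp (f.comp (k.comp j)) i)
    (le_range_comp (f.comp k) j) (le_range_comp f k)

/-- The identity embedding. -/
def _root_.AEC.Emb.id (h : K.Mem A) : K.Emb A A :=
  Emb.ofEquiv (FirstOrder.Language.Equiv.refl L A) h

theorem _root_.AEC.Emb.comp_id (f : K.Emb A B) : f.comp (Emb.id f.mem_left) = f :=
  Emb.ext fun _ => rfl

theorem NonforkingOver.restrict {j : K.Emb A B'} {k : K.Emb B' B} {p : K.GType B}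
    (h : s.NonforkingOver (k.comp j) p) (hA : K.MemCard lam A)
    (hB' : K.MemCard lam B') : s.NonforkingOver j (p.restrict k) := by
  rw [← Emb.comp_id (k.comp j)] at h
  exact h.mono hA hB'

theorem NonforkingOver.exists_tp {i : K.Emb A B} {p : K.GType B} (h : s.NonforkingOver i p) :
    ∃ (C : Type w) (_ : L.Structure C) (f : K.Emb B C) (c : C), K.MemCard lam C ∧ p = tp f c ∧
      c ∉ f.range := by
  obtain ⟨C, _, f, c, hp, hd⟩ := nonforkingOver_iff.1 h
  obtain ⟨-, -, hC, -, -, hc⟩ := s.dnf_dom _ _ _ hd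
  exact ⟨C, _, f, c, hC, hp, hc⟩

/-- The witness of non-forking lies outside the base, and algebraicity depends on the type alone, so
every realization avoids the base. -/
theorem NonforkingOver.notMem_range {i : K.Emb A B} {f : K.Emb B C} {c : C}
    (h : s.NonforkingOver i (tp f c)) : c ∉ f.range := by
  obtain ⟨C', _, f', c', -, hp, hc⟩ := h.exists_tp
  rintro ⟨b, hb⟩
  exact hc ⟨b, (mem_range_iff_of_tp_eq hp b).1 hb⟩

theorem bs_of_equiv {f : K.Emb B C} {f' : K.Emb B' C} {c : C} (ψ : B ≃[L] B')
    (hB : K.MemCard lam B) (hC : K.MemCard lam C) (hf : ∀ x, f'.map (ψ x) = f.map x)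
    (hc : c ∉ f.range) (h : tp f c ∈ s.bs B) : tp f' c ∈ s.bs B' :=
  s.bs_iso f f' ψ (FirstOrder.Language.Equiv.refl L C) c hB hC hf hc h

/-- Monotonicity raises the smaller model to `B` itself, where `dnf_basic` applies; the rest moves
the result from the image of `B` back to `B`. -/
theorem NonforkingOver.mem_bs {i : K.Emb A B} {p : K.GType B} (h : s.NonforkingOver i p)
    (hB : K.MemCard lam B) : p ∈ s.bs B := by
  obtain ⟨C, _, f, c, rfl, hd⟩ := nonforkingOver_iff.1 h
  obtain ⟨-, -, hC, -, -, hc⟩ := s.dnf_dom _ _ _ hd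
  have hle : K.Le f.range f.range := le_of_strong le_rfl f.strong f.strong
  have := s.dnf_basic _ _ f.strong_range
    (dnf_of_le hd (hB.range f) (hB.range f) (le_range_comp f i) hle hle)
  refine bs_of_equiv f.toRange.symm (hB.range f) hC (fun x => ?_) ?_ this
  · exact congrArg Subtype.val (f.toRange.apply_symm_apply x)
  · rwa [f.strong_range.range_emb]

theorem NonforkingOver.trans (htrans : s.Transitivity) {i : K.Emb A B} {j : K.Emb B C}
    {q : K.GType C} (hA : K.MemCard lam A) (hB : K.MemCard lam B) (hC : K.MemCard lam C)
    (h : s.NonforkingOver j q) (h' : s.NonforkingOver i (q.restrict j)) :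
    s.NonforkingOver (j.comp i) q := by
  refine htrans C _ _ (le_range_comp j i) j.strong_range (hA.range _) (hB.range _) hC q h ?_
  let e : K.Emb j.range B := Emb.ofEquiv j.toRange.symm j.mem_left
  let i' : K.Emb A j.range := (Emb.ofEquiv j.toRange j.strong_range.emb.mem_left).comp i
  have h1 : e.comp i' = i := Emb.ext fun a => j.toRange.symm_apply_apply _
  have h2 : j.comp e = j.strong_range.emb :=
    Emb.ext fun x => congrArg Subtype.val (j.toRange.apply_symm_apply x)
  rw [← h1] at h'
  have := h'.restrict hA (hB.range j)
  rw [restrict_restrict, h2] at this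
  have hr : i'.range = within (j.comp i).range j.range := by
    ext x
    constructor
    · rintro ⟨a, rfl⟩
      exact ⟨a, rfl⟩
    · rintro ⟨a, ha⟩
      exact ⟨a, Subtype.ext ha⟩
  rw [← hr]
  exact this

/-- Extension of a basic type along an embedding, with an amalgam that realizes it. -/
theorem Extension.exists_amalgam (hlam : Cardinal.aleph0 ≤ lam) (hAP : s.Amalgamation)
    (hext : s.Extension) {f : K.Emb B C} {c : C} (hB : K.MemCard lam B) (hC : K.MemCard lam C)
    (hc : c ∉ f.range) (h : tp f c ∈ s.bs B) (j : K.Emb B B') (hB' : K.MemCard lam B') :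
    ∃ (D : Type w) (_ : L.Structure D) (f' : K.Emb B' D) (k : K.Emb C D), K.MemCard lam D ∧
      (∀ b, f'.map (j.map b) = k.map (f.map b)) ∧ s.NonforkingOver j (tp f' (k.map c)) := by
  let e : K.Emb j.range B := Emb.ofEquiv j.toRange.symm j.mem_left
  let e' : K.Emb B j.range := Emb.ofEquiv j.toRange j.strong_range.emb.mem_left
  have hbs : tp (f.comp e) c ∈ s.bs j.range :=
    bs_of_equiv j.toRange hB hC
      (fun x => congrArg f.map (j.toRange.symm_apply_apply x)) hc h
  obtain ⟨q, -, hq, hnf⟩ := hext B' j.range j.strong_range (hB.range j) hB' _ hbs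
  obtain ⟨E, _, g, d, hE, rfl, -⟩ := NonforkingOver.exists_tp (i := j) hnf
  have heq : tp f c = tp (g.comp j) d := by
    -- The extension axiom only sees the copy `j.range` of `B`; restricting along `e'` brings the
    -- equality of types back to `B`.
    have := congrArg (fun r => GType.restrict e' r) hq
    rw [restrict_tp, restrict_tp, restrict_tp] at this
    rw [show f = (f.comp e).comp e' from
      Emb.ext fun x => (congrArg f.map (j.toRange.symm_apply_apply x)).symm, ← this]
    rfl
  obtain ⟨D, _, k, l, hD, h1, h2⟩ := hAP.exists_of_tp_eq hlam hB hC hE heq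
  refine ⟨D, _, l.comp g, k, hD, fun b => (h1 b).symm, ?_⟩
  rw [h2, tp_comp]
  exact hnf

end PreFrame

/-! ### Unions of chains of models and structures -/

namespace AEC

variable {L : FirstOrder.Language.{u, v}} {K : AEC.{u, v, w} L}

theorem range_inclusion {X : Type w} [L.Structure X] {A B : L.Substructure X} (h : A ≤ B) :
    (FirstOrder.Language.Substructure.inclusion h).toHom.range = within A B := by
  ext x
  constructor
  · rintro ⟨y, rfl⟩
    exact y.2
  · intro hx
    exact ⟨⟨x.1, hx⟩, rfl⟩

/-- The chain axiom makes every stage strong in the union; smoothness then makes the union strong in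
`N`. -/
theorem strong_union {N : Type w} [L.Structure N] (hN : K.Mem N) {δ : Ordinal.{w}}
    (hδ : Order.IsSuccLimit δ) (A : Ordinal.{w} → L.Substructure N)
    (hA : ∀ α < δ, K.Strong (A α)) (hmono : ∀ α β, α ≤ β → β < δ → A α ≤ A β)
    (hcont : ∀ γ < δ, Order.IsSuccLimit γ → ∀ x ∈ A γ, ∃ α < γ, x ∈ A α)
    {A' : L.Substructure N} (hA' : ∀ x, x ∈ A' ↔ ∃ α < δ, x ∈ A α) : K.Strong A' := by
  have hle : ∀ α < δ, A α ≤ A' := fun α hα x hx => (hA' x).2 ⟨α, hα, hx⟩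
  have h1 : ∀ α < δ, K.Strong (within (A α) A') := by
    refine (K.chain (M := A') δ (fun α => within (A α) A') hδ.bot_lt ?_ ?_).2
    · intro α β hαβ hβ
      refine ⟨fun x hx => hmono α β hαβ hβ hx, ?_⟩
      have := strong_within_range
        (le_of_strong (hmono α β hαβ hβ) (hA α (hαβ.trans_lt hβ)) (hA β hβ)).emb
        (FirstOrder.Language.Substructure.inclusion (hle β hβ))
        (FirstOrder.Language.Substructure.inclusion (hle α (hαβ.trans_lt hβ))) (fun _ => rfl)
      rwa [range_inclusion, range_inclusion] at this
    · intro x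
      obtain ⟨α, hα, hx⟩ := (hA' x).1 x.2
      exact ⟨α, hα, hx⟩
  have hmem : K.Mem A' := (K.strong_dom _ (h1 0 hδ.bot_lt)).2
  have htop : K.Strong (within A' A') := by
    convert K.strong_refl A' hmem
    exact eq_top_iff.2 fun x _ => x.2
  -- Smoothness takes a sequence defined at `δ` as well, so the union is spliced in as the value
  -- there.
  obtain ⟨B, hB, hB'⟩ : ∃ B : Ordinal.{w} → L.Substructure N, (∀ α < δ, B α = A α) ∧ B δ = A' := by
    classical
    refine ⟨fun α => if α < δ then A α else A', fun α hα => if_pos hα, if_neg (lt_irrefl δ)⟩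
  rw [← hB']
  refine K.smooth δ B hδ hN ?_ ?_ ?_
  · intro α β hαβ hβ
    rcases hβ.lt_or_eq with hβ | rfl
    · have hα := hαβ.trans_lt hβ
      rw [hB α hα, hB β hβ]
      exact le_of_strong (hmono α β hαβ hβ) (hA α hα) (hA β hβ)
    · rcases hαβ.lt_or_eq with hα | rfl
      · rw [hB α hα, hB']
        exact ⟨hle α hα, h1 α hα⟩
      · rw [hB']
        exact ⟨le_rfl, htop⟩
  · intro γ hγ hlim x hx
    rcases hγ.lt_or_eq with hγ | rfl
    · rw [hB γ hγ] at hx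
      obtain ⟨α, hα, hx⟩ := hcont γ hγ hlim x hx
      exact ⟨α, hα, by rwa [hB α (hα.trans hγ)]⟩
    · rw [hB'] at hx
      obtain ⟨α, hα, hx⟩ := (hA' x).1 hx
      exact ⟨α, hα, by rwa [hB α hα]⟩
  · intro α hα
    rw [hB α hα]
    exact hA α hα

end AEC

theorem exists_common_index {U : Type*} {δ : Ordinal.{w}} (hδ : 0 < δ)
    {Y : Ordinal.{w} → Set U} (hY : ∀ α β, α ≤ β → β < δ → Y α ⊆ Y β) {n : ℕ} (x : Fin n → U)
    (hx : ∀ i, ∃ α < δ, x i ∈ Y α) : ∃ α < δ, ∀ i, x i ∈ Y α := by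
  choose α hα hx using hx
  have hlt : Finset.univ.sup α < δ := (Finset.sup_lt_iff hδ).2 fun i _ => hα i
  exact ⟨_, hlt, fun i => hY _ _ (Finset.le_sup (Finset.mem_univ i)) hlt (hx i)⟩

/-- A function on a directed union of substructures, whose restrictions to these are embeddings,
is an embedding. -/
theorem exists_embedding_of_union {L : FirstOrder.Language.{u, v}} {A B : Type w} [L.Structure A]
    [L.Structure B] {δ : Ordinal.{w}} (hδ : 0 < δ) {P : Ordinal.{w} → L.Substructure A}
    (hP : ∀ α β, α ≤ β → β < δ → P α ≤ P β) (hA : ∀ a, ∃ α < δ, a ∈ P α) (g : A → B)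
    (hg : ∀ α < δ, ∃ e : P α ↪[L] B, ∀ x, e x = g x) : ∃ G : A ↪[L] B, ∀ a, G a = g a := by
  have key : ∀ {n : ℕ} (x : Fin n → A), ∃ (α : Ordinal.{w}) (y : Fin n → P α) (e : P α ↪[L] B),
      (∀ z, e z = g z) ∧ x = (P α).subtype ∘ y := by
    intro n x
    obtain ⟨α, hα, hx⟩ := exists_common_index hδ (Y := fun α => (P α : Set A)) hP x
      fun i => hA (x i)
    obtain ⟨e, he⟩ := hg α hα
    exact ⟨α, fun i => ⟨x i, hx i⟩, e, he, rfl⟩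
  have hcomp : ∀ {n : ℕ} {α : Ordinal.{w}} (y : Fin n → P α) (e : P α ↪[L] B),
      (∀ z, e z = g z) → g ∘ ((P α).subtype ∘ y) = e ∘ y := by
    intro n α y e he
    funext i
    exact (he _).symm
  refine ⟨⟨⟨g, ?_⟩, ?_, ?_⟩, fun _ => rfl⟩
  · intro a b hab
    obtain ⟨α, y, e, he, hxy⟩ := key ![a, b]
    have h0 : a = y 0 := congrFun hxy 0
    have h1 : b = y 1 := congrFun hxy 1
    rw [h0, h1, ← he, ← he] at hab
    rw [h0, h1, e.injective hab]
  · intro n f x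
    obtain ⟨α, y, e, he, rfl⟩ := key x
    change g _ = FirstOrder.Language.Structure.funMap f (g ∘ _)
    rw [hcomp y e he, ← e.map_fun, ← FirstOrder.Language.Embedding.map_fun, he]
    rfl
  · intro n r x
    obtain ⟨α, y, e, he, rfl⟩ := key x
    change FirstOrder.Language.Structure.RelMap r (g ∘ _) ↔ _
    rw [hcomp y e he, e.map_rel, FirstOrder.Language.Embedding.map_rel]

/-- A structure whose underlying set is a subset of `U`. -/
structure SubsetModel (L : FirstOrder.Language.{u, v}) (U : Type w) where
  carrier : Set U
  str : L.Structure carrier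

namespace SubsetModel

variable {L : FirstOrder.Language.{u, v}} {U : Type w}

instance (X : SubsetModel L U) : L.Structure X.carrier := X.str

theorem exists_equiv_of_injective {D : Type w} [L.Structure D] {φ : D → U}
    (hφ : Function.Injective φ) :
    ∃ (Y : SubsetModel L U) (e : D ≃[L] Y.carrier), ∀ d, (e d : U) = φ d := by
  let e : D ≃ Set.range φ := Equiv.ofInjective φ hφ
  exact ⟨⟨Set.range φ, e.inducedStructure⟩, e.inducedStructureEquiv, fun d => rfl⟩

/-- An extension of `X` which is not too large is isomorphic to one with underlying set contained
in `U`. -/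
theorem exists_equiv_of_extension (hU : Cardinal.aleph0 ≤ Cardinal.mk U) (X : SubsetModel L U)
    (hX : Cardinal.mk X.carrier < Cardinal.mk U) {D : Type w} [L.Structure D]
    (hD : Cardinal.mk D ≤ Cardinal.mk U) (f : X.carrier → D) (hf : Function.Injective f) :
    ∃ (Y : SubsetModel L U) (e : D ≃[L] Y.carrier), ∀ x, (e (f x) : U) = x := by
  have hc : Cardinal.mk ↥(X.carrierᶜ) = Cardinal.mk U := by
    have : Infinite U := Cardinal.infinite_iff.2 hU
    exact Cardinal.mk_compl_of_infinite X.carrier hX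
  rw [← hc] at hD
  obtain ⟨i⟩ := hD
  classical
  -- Points coming from `X` return to their original place; all others go injectively into the
  -- complement of `X`, which has the size of `U`.
  let φ : D → U := fun d => if h : ∃ x, f x = d then (h.choose : U) else (i d : U)
  have h1 : ∀ x, φ (f x) = x := by
    intro x
    have h : ∃ y, f y = f x := ⟨x, rfl⟩
    simp only [φ, dif_pos h]
    rw [hf h.choose_spec]
  have h2 : ∀ d, (¬ ∃ x, f x = d) → φ d = i d := fun d h => by simp only [φ, dif_neg h]
  have hφ : Function.Injective φ := by
    intro d d' hdd'
    by_cases h : ∃ x, f x = d <;> by_cases h' : ∃ x, f x = d'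
    · obtain ⟨x, rfl⟩ := h
      obtain ⟨x', rfl⟩ := h'
      rw [h1, h1] at hdd'
      rw [Subtype.ext hdd']
    · obtain ⟨x, rfl⟩ := h
      rw [h1, h2 _ h'] at hdd'
      exact absurd (hdd' ▸ x.2) (i d').2
    · obtain ⟨x', rfl⟩ := h'
      rw [h1, h2 _ h] at hdd'
      exact absurd (hdd'.symm ▸ x'.2) (i d).2
    · rw [h2 _ h, h2 _ h'] at hdd'
      exact i.injective (Subtype.ext hdd')
  obtain ⟨Y, e, he⟩ := exists_equiv_of_injective (L := L) hφ
  exact ⟨Y, e, fun x => (he _).trans (h1 x)⟩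

/-- The union of an increasing sequence of structures. -/
theorem exists_union {δ : Ordinal.{w}} (hδ : 0 < δ) (X : Ordinal.{w} → SubsetModel L U)
    (hX : ∀ α β, α ≤ β → β < δ →
      ∃ j : (X α).carrier ↪[L] (X β).carrier, ∀ x, (j x : U) = x) :
    ∃ Y : SubsetModel L U, (∀ x, x ∈ Y.carrier ↔ ∃ α < δ, x ∈ (X α).carrier) ∧
      ∀ α < δ, ∃ j : (X α).carrier ↪[L] Y.carrier, ∀ x, (j x : U) = x := by
  have hmono : ∀ α β, α ≤ β → β < δ → (X α).carrier ⊆ (X β).carrier := by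
    intro α β hαβ hβ x hx
    obtain ⟨j, hj⟩ := hX α β hαβ hβ
    have := (j ⟨x, hx⟩).2
    rwa [hj] at this
  have hfun : ∀ α β, α < δ → β < δ → ∀ {n : ℕ} (f : L.Functions n) (x : Fin n → U)
      (hα : ∀ i, x i ∈ (X α).carrier) (hβ : ∀ i, x i ∈ (X β).carrier),
      ((FirstOrder.Language.Structure.funMap f (fun i => ⟨x i, hα i⟩) : (X α).carrier) : U) =
        (FirstOrder.Language.Structure.funMap f (fun i => ⟨x i, hβ i⟩) : (X β).carrier) := by
    intro α β hα hβ
    wlog h : α ≤ β generalizing α β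
    · intro n f x h1 h2
      exact (this β α hβ hα (le_of_not_ge h) f x h2 h1).symm
    intro n f x h1 h2
    obtain ⟨j, hj⟩ := hX α β h hβ
    rw [← hj, j.map_fun]
    congr 2
    funext i
    exact Subtype.ext (hj _)
  have hrel : ∀ α β, α < δ → β < δ → ∀ {n : ℕ} (r : L.Relations n) (x : Fin n → U)
      (hα : ∀ i, x i ∈ (X α).carrier) (hβ : ∀ i, x i ∈ (X β).carrier),
      (FirstOrder.Language.Structure.RelMap r (fun i => (⟨x i, hα i⟩ : (X α).carrier)) ↔
        FirstOrder.Language.Structure.RelMap r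
          (fun i => (⟨x i, hβ i⟩ : (X β).carrier))) := by
    intro α β hα hβ
    wlog h : α ≤ β generalizing α β
    · intro n r x h1 h2
      exact (this β α hβ hα (le_of_not_ge h) r x h2 h1).symm
    intro n r x h1 h2
    obtain ⟨j, hj⟩ := hX α β h hβ
    rw [← j.map_rel]
    have : (j ∘ fun i => (⟨x i, h1 i⟩ : (X α).carrier)) = fun i => ⟨x i, h2 i⟩ := by
      funext i
      exact Subtype.ext (hj _)
    rw [this]
  let Z : Set U := {x | ∃ α < δ, x ∈ (X α).carrier}
  have hcommon : ∀ {n : ℕ} (x : Fin n → Z), ∃ α < δ, ∀ i, (x i : U) ∈ (X α).carrier :=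
    fun x => exists_common_index hδ (Y := fun α => (X α).carrier) hmono (fun i => (x i : U))
      fun i => (x i).2
  -- Functions and relations are evaluated at a chosen stage containing all arguments; `hfun` and
  -- `hrel` make the choice irrelevant.
  choose c hc hcx using @hcommon
  let strZ : L.Structure Z :=
    { funMap := fun f x => ⟨(FirstOrder.Language.Structure.funMap f
        (fun i => ⟨x i, hcx x i⟩) : (X (c x)).carrier), c x, hc x, Subtype.property _⟩
      RelMap := fun r x => FirstOrder.Language.Structure.RelMap r
        (fun i => (⟨x i, hcx x i⟩ : (X (c x)).carrier)) }
  refine ⟨⟨Z, strZ⟩, fun x => Iff.rfl, fun α hα => ?_⟩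
  refine ⟨⟨⟨fun x => ⟨x, α, hα, x.2⟩,
    fun x y hxy => Subtype.ext (congrArg (fun z : Z => (z : U)) hxy)⟩, ?_, ?_⟩, fun x => rfl⟩
  · intro n f x
    apply Subtype.ext
    exact hfun α _ hα (hc _) f (fun i => (x i : U)) (fun i => (x i).2) _
  · intro n r x
    exact (hrel α _ hα (hc _) r (fun i => (x i : U)) (fun i => (x i).2) _).symm

end SubsetModel

/-! ### Transfinite recursion -/

/-- Construction of increasing continuous sequences by transfinite recursion. -/
theorem exists_continuous_chain {T : Type*} (le : T → T → Prop) (hrefl : ∀ x, le x x)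
    (htrans : ∀ x y z, le x y → le y z → le x z) (κ : Ordinal.{w}) (Inv : T → Prop)
    (Step : Ordinal.{w} → T → T → Prop) (Lim : Ordinal.{w} → (Ordinal.{w} → T) → T → Prop)
    (hcongr : ∀ δ f g t, (∀ α < δ, f α = g α) → Lim δ f t → Lim δ g t) (x₀ : T) (h0 : Inv x₀)
    (hstep : ∀ α < κ, ∀ x, Inv x → ∃ y, le x y ∧ Inv y ∧ Step α x y)
    (hlim : ∀ δ < κ, Order.IsSuccLimit δ → ∀ f : Ordinal.{w} → T, f 0 = x₀ →
      (∀ α β, α ≤ β → β < δ → le (f α) (f β)) → (∀ α < δ, Inv (f α)) →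
      (∀ γ < δ, Order.IsSuccLimit γ → Lim γ f (f γ)) →
      ∃ y, (∀ α < δ, le (f α) y) ∧ Inv y ∧ Lim δ f y) :
    ∃ f : Ordinal.{w} → T, f 0 = x₀ ∧ (∀ α β, α ≤ β → β < κ → le (f α) (f β)) ∧
      (∀ α < κ, Inv (f α)) ∧ (∀ α, α + 1 < κ → Step α (f α) (f (α + 1))) ∧
      ∀ δ < κ, Order.IsSuccLimit δ → Lim δ f (f δ) := by
  classical
  -- Inside the recursion only the values below `δ` exist. The default `x₀` beyond `δ` is harmless
  -- because `hcongr` makes `Lim δ` depend only on values below `δ`.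
  let ext : (δ : Ordinal.{w}) → (∀ α < δ, T) → Ordinal.{w} → T :=
    fun δ ih α => if h : α < δ then ih α h else x₀
  let f : Ordinal.{w} → T := fun o => Ordinal.limitRecOn o x₀
    (fun α x => if h : ∃ y, le x y ∧ Inv y ∧ Step α x y then h.choose else x)
    (fun δ _ ih => if h : ∃ y, (∀ α < δ, le (ext δ ih α) y) ∧ Inv y ∧ Lim δ (ext δ ih) y
      then h.choose else x₀)
  have f0 : f 0 = x₀ := Ordinal.limitRecOn_zero _ _ _
  have fsucc : ∀ α, (∃ y, le (f α) y ∧ Inv y ∧ Step α (f α) y) →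
      le (f α) (f (α + 1)) ∧ Inv (f (α + 1)) ∧ Step α (f α) (f (α + 1)) := by
    intro α h
    have : f (α + 1) = h.choose := by
      refine (Ordinal.limitRecOn_add_one _ _ _ _).trans ?_
      exact dif_pos h
    rw [this]
    exact h.choose_spec
  have flim : ∀ δ, Order.IsSuccLimit δ →
      (∃ y, (∀ α < δ, le (f α) y) ∧ Inv y ∧ Lim δ f y) →
      (∀ α < δ, le (f α) (f δ)) ∧ Inv (f δ) ∧ Lim δ f (f δ) := by
    intro δ hδ h
    have hext : ∀ α < δ, ext δ (fun α _ => f α) α = f α := fun α hα => dif_pos hα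
    have h' : ∃ y, (∀ α < δ, le (ext δ (fun α _ => f α) α) y) ∧ Inv y ∧
        Lim δ (ext δ (fun α _ => f α)) y := by
      obtain ⟨y, h1, h2, h3⟩ := h
      refine ⟨y, fun α hα => ?_, h2, hcongr δ _ _ y (fun α hα => (hext α hα).symm) h3⟩
      rw [hext α hα]
      exact h1 α hα
    have hf : f δ = h'.choose := by
      refine (Ordinal.limitRecOn_limit _ _ _ _ hδ).trans ?_
      exact dif_pos h'
    rw [hf]
    obtain ⟨h1, h2, h3⟩ := h'.choose_spec
    refine ⟨fun α hα => ?_, h2, hcongr δ _ _ _ hext h3⟩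
    have := h1 α hα
    rwa [hext α hα] at this
  -- The invariant, the order and the limit clause are proved together, since `hstep` and `hlim`
  -- need them at earlier stages. In particular the default branches of the recursion are never
  -- taken below `κ`.
  have main : ∀ β < κ, Inv (f β) ∧ (∀ α ≤ β, le (f α) (f β)) ∧
      (Order.IsSuccLimit β → Lim β f (f β)) := by
    intro β
    induction β using Ordinal.limitRecOn with
    | zero =>
      intro _
      refine ⟨f0 ▸ h0, fun α hα => ?_, fun h => absurd rfl h.ne_bot⟩
      rw [nonpos_iff_eq_zero.1 hα]
      exact hrefl _
    | add_one β ih =>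
      intro hβ
      have hβ' : β < κ := (lt_add_one β).trans hβ
      obtain ⟨h1, h2, -⟩ := ih hβ'
      obtain ⟨h3, h4, -⟩ := fsucc β (hstep β hβ' _ h1)
      refine ⟨h4, fun α hα => ?_, fun h => ?_⟩
      · rcases hα.lt_or_eq with hα | rfl
        · exact htrans _ _ _ (h2 α (Order.lt_add_one_iff.1 hα)) h3
        · exact hrefl _
      · exact absurd h (Order.not_isSuccLimit_add_one β)
    | limit δ hδ ih =>
      intro hδκ
      obtain ⟨h1, h2, h3⟩ := flim δ hδ (hlim δ hδκ hδ f f0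
        (fun α β hαβ hβ => (ih β hβ (hβ.trans hδκ)).2.1 α hαβ)
        (fun α hα => (ih α hα (hα.trans hδκ)).1)
        (fun γ hγ hγlim => (ih γ hγ (hγ.trans hδκ)).2.2 hγlim))
      refine ⟨h2, fun α hα => ?_, fun _ => h3⟩
      rcases hα.lt_or_eq with hα | rfl
      · exact h1 α hα
      · exact hrefl _
  refine ⟨f, f0, fun α β hαβ hβ => (main β hβ).2.1 α hαβ, fun α hα => (main α hα).1,
    fun α hα => ?_, fun δ hδ => (main δ hδ).2.2⟩
  have hα' : α < κ := (lt_add_one α).trans hα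
  exact (fsucc α (hstep α hα' _ (main α hα').1)).2.2

/-! ### Partial embeddings and their unions -/

namespace AEC

variable {L : FirstOrder.Language.{u, v}}

/-- An embedding of a strong submodel of `N` into a model with underlying set contained in `U`. -/
structure PartialEmb (K : AEC.{u, v, w} L) (N : Type w) [L.Structure N] (U : Type w) where
  dom : L.Substructure N
  strong : K.Strong dom
  cod : SubsetModel L U
  emb : K.Emb dom cod.carrier

namespace PartialEmb

variable {K : AEC.{u, v, w} L} {N : Type w} [L.Structure N] {U : Type w}

/-- Extension of partial embeddings, in the domain and in the target. -/
def Extends (s t : K.PartialEmb N U) : Prop :=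
  s.dom ≤ t.dom ∧ (∃ j : K.Emb s.cod.carrier t.cod.carrier, ∀ x, (j.map x : U) = x) ∧
    ∀ n (hs : n ∈ s.dom) (ht : n ∈ t.dom), (s.emb.map ⟨n, hs⟩ : U) = t.emb.map ⟨n, ht⟩

theorem extends_refl (s : K.PartialEmb N U) : s.Extends s :=
  ⟨le_rfl, ⟨Emb.ofEquiv (FirstOrder.Language.Equiv.refl L _) s.emb.mem_right, fun _ => rfl⟩,
    fun _ _ _ => rfl⟩

theorem extends_trans (s t r : K.PartialEmb N U) (h : s.Extends t) (h' : t.Extends r) :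
    s.Extends r := by
  obtain ⟨h1, ⟨j, hj⟩, h2⟩ := h
  obtain ⟨h1', ⟨j', hj'⟩, h2'⟩ := h'
  exact ⟨h1.trans h1', ⟨j'.comp j, fun x => (hj' _).trans (hj x)⟩,
    fun n hs hr => (h2 n hs (h1 hs)).trans (h2' n _ hr)⟩

theorem Extends.cod_subset {s t : K.PartialEmb N U} (h : s.Extends t) :
    s.cod.carrier ⊆ t.cod.carrier := by
  intro x hx
  obtain ⟨-, ⟨j, hj⟩, -⟩ := h
  have := (j.map ⟨x, hx⟩).2
  rwa [hj] at this

theorem Extends.le {s t : K.PartialEmb N U} (h : s.Extends t) : K.Le s.dom t.dom :=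
  le_of_strong h.1 s.strong t.strong

theorem Extends.exists_emb {s t : K.PartialEmb N U} (h : s.Extends t) :
    ∃ j : K.Emb s.cod.carrier t.cod.carrier, (∀ x, (j.map x : U) = x) ∧
      ∀ n, j.map (s.emb.map n) = t.emb.map (h.le.emb.map n) := by
  obtain ⟨j, hj⟩ := h.2.1
  exact ⟨j, hj, fun n => Subtype.ext ((hj _).trans (h.2.2 n n.2 (h.1 n.2)))⟩

/-- `t` is the union of the sequence `S α`, `α < δ`. -/
def IsUnion (δ : Ordinal.{w}) (S : Ordinal.{w} → K.PartialEmb N U) (t : K.PartialEmb N U) : Prop :=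
  (∀ n, n ∈ t.dom ↔ ∃ α < δ, n ∈ (S α).dom) ∧
    ∀ x, x ∈ t.cod.carrier ↔ ∃ α < δ, x ∈ (S α).cod.carrier

theorem IsUnion.congr (δ : Ordinal.{w}) (S S' : Ordinal.{w} → K.PartialEmb N U)
    (t : K.PartialEmb N U) (h : ∀ α < δ, S α = S' α) (hS : IsUnion δ S t) : IsUnion δ S' t := by
  refine ⟨fun n => (hS.1 n).trans ?_, fun n => (hS.2 n).trans ?_⟩ <;>
  · refine exists_congr fun α => and_congr_right fun hα => ?_
    rw [h α hα]

/-- The domain is a union inside `N`, hence strong by smoothness. The target is assembled on the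
union of the carriers and is a model by the chain axiom. The glued map has strong range because that
range is a continuous union of strong submodels of the new target. -/
theorem exists_isUnion (hN : K.Mem N) {δ : Ordinal.{w}} (hδ : Order.IsSuccLimit δ)
    (S : Ordinal.{w} → K.PartialEmb N U)
    (hS : ∀ α β, α ≤ β → β < δ → (S α).Extends (S β))
    (hcont : ∀ γ < δ, Order.IsSuccLimit γ → IsUnion γ S (S γ)) :
    ∃ t : K.PartialEmb N U, (∀ α < δ, (S α).Extends t) ∧ IsUnion δ S t := by
  have hδ0 : 0 < δ := hδ.bot_lt
  -- the values of the sequence beyond `δ` may be assumed to be harmless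
  wlog hconst : ∀ α, ¬ α < δ → S α = S 0 generalizing S
  · classical
    let S' : Ordinal.{w} → K.PartialEmb N U := fun α => if α < δ then S α else S 0
    have h1 : ∀ α < δ, S' α = S α := fun α hα => if_pos hα
    obtain ⟨t, ht, htU⟩ := this S' (by
        intro α β hαβ hβ
        rw [h1 α (hαβ.trans_lt hβ), h1 β hβ]
        exact hS α β hαβ hβ) (by
        intro γ hγ hlim
        rw [h1 γ hγ]
        exact (hcont γ hγ hlim).congr _ _ _ _ fun α hα => (h1 α (hα.trans hγ)).symm) (by
        intro α hα
        rw [h1 0 hδ0]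
        exact if_neg hα)
    refine ⟨t, fun α hα => ?_, htU.congr _ _ _ _ h1⟩
    rw [← h1 α hα]
    exact ht α hα
  -- the domain
  obtain ⟨A, hA⟩ : ∃ A : L.Substructure N, ∀ n, n ∈ A ↔ ∃ α < δ, n ∈ (S α).dom := by
    have : Nonempty (Set.Iio δ) := ⟨⟨0, hδ0⟩⟩
    refine ⟨⨆ α : Set.Iio δ, (S α).dom, fun n => ?_⟩
    rw [FirstOrder.Language.Substructure.mem_iSup_of_directed]
    · constructor
      · rintro ⟨⟨α, hα⟩, h⟩
        exact ⟨α, hα, h⟩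
      · rintro ⟨α, hα, h⟩
        exact ⟨⟨α, hα⟩, h⟩
    · refine Monotone.directed_le fun α β hαβ => (hS α β hαβ β.2).1
  have hAs : K.Strong A := strong_union hN hδ (fun α => (S α).dom) (fun α _ => (S α).strong)
    (fun α β hαβ hβ => (hS α β hαβ hβ).1)
    (fun γ hγ hlim x hx => ((hcont γ hγ hlim).1 x).1 hx) hA
  have hAle : ∀ α < δ, (S α).dom ≤ A := fun α hα n hn => (hA n).2 ⟨α, hα, hn⟩
  -- the target
  obtain ⟨Y, hY, hj⟩ := SubsetModel.exists_union hδ0 (fun α => (S α).cod) (by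
    intro α β hαβ hβ
    obtain ⟨-, ⟨j, hj⟩, -⟩ := hS α β hαβ hβ
    exact ⟨j.map, hj⟩)
  -- The chain axiom expects a sequence on all ordinals; beyond `δ` the map of stage `0` is reused.
  have hj : ∀ α, ∃ j : (S α).cod.carrier ↪[L] Y.carrier, ∀ x, (j x : U) = x := by
    intro α
    by_cases hα : α < δ
    · exact hj α hα
    · rw [hconst α hα]
      exact hj 0 hδ0
  choose j hj using hj
  obtain ⟨hYmem, hjs⟩ := K.chain (M := Y.carrier) δ (fun α => (j α).toHom.range) hδ0 (by
    intro α β hαβ hβ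
    obtain ⟨i, hi, -⟩ := (hS α β hαβ hβ).exists_emb
    have hcomm : ∀ x, j β (i.map x) = j α x := fun x =>
      Subtype.ext ((hj β _).trans ((hi x).trans (hj α x).symm))
    refine ⟨?_, strong_within_range i (j β) (j α) hcomm⟩
    rintro _ ⟨x, rfl⟩
    exact ⟨i.map x, hcomm x⟩) (by
    intro x
    obtain ⟨α, hα, hx⟩ := (hY x).1 x.2
    exact ⟨α, hα, ⟨x, hx⟩, Subtype.ext (hj α _)⟩)
  -- the embedding
  have hval : ∀ α β, α < δ → β < δ → ∀ n (hα : n ∈ (S α).dom) (hβ : n ∈ (S β).dom),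
      ((S α).emb.map ⟨n, hα⟩ : U) = (S β).emb.map ⟨n, hβ⟩ := by
    intro α β hα hβ n h1 h2
    rcases le_total α β with h | h
    · exact (hS α β h hβ).2.2 n h1 h2
    · exact ((hS β α h hα).2.2 n h2 h1).symm
  have hg : ∀ n : A, ∃ y : Y.carrier, ∀ α < δ, ∀ h : (n : N) ∈ (S α).dom,
      (y : U) = (S α).emb.map ⟨n, h⟩ := by
    intro n
    obtain ⟨α, hα, hn⟩ := (hA n).1 n.2
    exact ⟨⟨(S α).emb.map ⟨n, hn⟩, (hY _).2 ⟨α, hα, Subtype.property _⟩⟩,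
      fun β hβ h => hval α β hα hβ n hn h⟩
  choose g hg using hg
  obtain ⟨G, hG⟩ := exists_embedding_of_union hδ0 (P := fun α => within (S α).dom A)
    (fun α β hαβ hβ n hn => (hS α β hαβ hβ).1 hn)
    (fun n => (hA n).1 n.2) g (by
      intro α hα
      refine ⟨((j α).comp (S α).emb.map).comp
        ((A.subtype.comp (within (S α).dom A).subtype).codRestrict _ fun n => n.2), fun n => ?_⟩
      exact Subtype.ext ((hj α _).trans (hg _ α hα n.2).symm))
  have hGval : ∀ α, α < δ → ∀ n (h : n ∈ (S α).dom) (h' : n ∈ A),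
      (G ⟨n, h'⟩ : U) = (S α).emb.map ⟨n, h⟩ := by
    intro α hα n h h'
    rw [hG]
    exact hg _ α hα h
  have hGs : K.Strong G.toHom.range := by
    refine strong_union hYmem hδ (fun α => ((j α).comp (S α).emb.map).toHom.range) ?_ ?_ ?_ ?_
    · intro α hα
      exact (Emb.comp ⟨j α, hjs α hα⟩ (S α).emb).strong
    · rintro α β hαβ hβ _ ⟨n, rfl⟩
      refine ⟨⟨n, (hS α β hαβ hβ).1 n.2⟩, Subtype.ext ?_⟩
      refine (hj β _).trans (Eq.trans ?_ (hj α _).symm)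
      exact hval β α hβ (hαβ.trans_lt hβ) n _ n.2
    · rintro γ hγ hlim _ ⟨n, rfl⟩
      obtain ⟨α, hα, hn⟩ := ((hcont γ hγ hlim).1 n).1 n.2
      refine ⟨α, hα, ⟨n, hn⟩, Subtype.ext ?_⟩
      refine (hj α _).trans (Eq.trans ?_ (hj γ _).symm)
      exact hval α γ (hα.trans hγ) hγ n _ n.2
    · intro x
      constructor
      · rintro ⟨n, rfl⟩
        obtain ⟨α, hα, hn⟩ := (hA n).1 n.2
        refine ⟨α, hα, ⟨n, hn⟩, Subtype.ext ?_⟩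
        exact (hj α _).trans (hGval α hα n hn n.2).symm
      · rintro ⟨α, hα, n, rfl⟩
        refine ⟨⟨n, hAle α hα n.2⟩, Subtype.ext ?_⟩
        exact (hGval α hα n n.2 _).trans (hj α _).symm
  refine ⟨⟨A, hAs, Y, ⟨G, hGs⟩⟩, fun α hα => ⟨hAle α hα, ⟨⟨j α, hjs α hα⟩, hj α⟩, ?_⟩, hA, hY⟩
  intro n h h'
  exact (hGval α hα n h h').symm

end PartialEmb

end AEC

/-! ### Ordinals and clubs below `lam⁺` -/

theorem card_le_of_lt_ord_succ {lam : Cardinal.{w}} {δ : Ordinal.{w}}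
    (hδ : δ < (Order.succ lam).ord) : δ.card ≤ lam :=
  Order.lt_succ_iff.1 (Cardinal.lt_ord.1 hδ)

theorem isSuccLimit_ord_succ {lam : Cardinal.{w}} (hlam : Cardinal.aleph0 ≤ lam) :
    Order.IsSuccLimit (Order.succ lam).ord :=
  Cardinal.isSuccLimit_ord (hlam.trans (Order.le_succ lam))

theorem exists_code {κ : Cardinal.{w}} {V : Type w} (hV : Cardinal.mk V ≤ κ) :
    ∃ e : V → Ordinal.{w}, Function.Injective e ∧ ∀ x, e x < κ.ord := by
  rw [← Cardinal.mk_ord_toType κ] at hV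
  obtain ⟨i⟩ := hV
  refine ⟨fun x => (Ordinal.ToType.mk.symm (i x) : Set.Iio κ.ord), fun x y hxy => ?_,
    fun x => (Ordinal.ToType.mk.symm (i x)).2⟩
  exact i.injective (Ordinal.ToType.mk.symm.injective (Subtype.ext hxy))

/-- Fewer than `lam⁺` ordinals below `lam⁺` are bounded below `lam⁺`. -/
theorem exists_bound {lam : Cardinal.{w}} (hlam : Cardinal.aleph0 ≤ lam) {B : Type w}
    (hB : Cardinal.mk B ≤ lam) {f : B → Ordinal.{w}} (hf : ∀ b, f b < (Order.succ lam).ord) :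
    ∃ γ < (Order.succ lam).ord, ∀ b, f b < γ := by
  refine ⟨⨆ b, f b + 1, Ordinal.iSup_add_one_lt_of_lt_cof ?_ hf, fun b => ?_⟩
  · rw [(Cardinal.isRegular_succ hlam).cof_ord]
    exact Order.lt_succ_iff.2 hB
  · exact (lt_add_one (f b)).trans_le (Ordinal.le_iSup (fun b => f b + 1) b)

theorem isSuccLimit_of_forall_lt {δ : Ordinal.{w}} (h0 : 0 < δ) (h : ∀ β < δ, β + 1 < δ) :
    Order.IsSuccLimit δ :=
  ⟨not_isMin_iff.2 ⟨0, h0⟩, Order.isSuccPrelimit_of_succ_lt h⟩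

/-- The closure points of a relation on `lam⁺` form a club. -/
theorem isClub_closurePoints {lam : Cardinal.{w}} (hlam : Cardinal.aleph0 ≤ lam)
    {Q : Ordinal.{w} → Ordinal.{w} → Prop} (hanti : ∀ β β' γ, β ≤ β' →
      β' < (Order.succ lam).ord → Q β' γ → Q β γ)
    (hex : ∀ β < (Order.succ lam).ord, ∃ γ < (Order.succ lam).ord, Q β γ) :
    IsClub {δ : Set.Iio (Order.succ lam).ord | Order.IsSuccLimit (δ : Ordinal.{w}) ∧
      ∀ β < (δ : Ordinal.{w}), ∃ γ < (δ : Ordinal.{w}), Q β γ} := by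
  have hκ := isSuccLimit_ord_succ hlam
  constructor
  · intro d hd hd0 _ a ha
    have hlt : ∀ β < (a : Ordinal.{w}), ∃ δ ∈ d, β < (δ : Ordinal.{w}) ∧ δ ≤ a := by
      intro β hβ
      by_contra! hcon
      have hub : (⟨β, hβ.trans a.2⟩ : Set.Iio (Order.succ lam).ord) ∈ upperBounds d := by
        intro δ hδ
        by_contra! hlt
        exact absurd (hcon δ hδ hlt) (not_lt_of_ge (ha.1 hδ))
      exact absurd (ha.2 hub) (not_le_of_gt hβ)
    obtain ⟨δ₀, hδ₀⟩ := hd0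
    refine ⟨isSuccLimit_of_forall_lt ((hd hδ₀).1.bot_lt.trans_le (ha.1 hδ₀)) fun β hβ => ?_,
      fun β hβ => ?_⟩
    · obtain ⟨δ, hδ, hβδ, hδa⟩ := hlt β hβ
      exact ((hd hδ).1.add_one_lt hβδ).trans_le hδa
    · obtain ⟨δ, hδ, hβδ, hδa⟩ := hlt β hβ
      obtain ⟨γ, hγ, hQ⟩ := (hd hδ).2 β hβδ
      exact ⟨γ, hγ.trans_le hδa, hQ⟩
  · intro a
    choose! g hg hgQ using hex
    -- Iterating the witness function from above `a` gives a closure point as supremum; `hanti`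
    -- reduces an arbitrary `β` below it to some `x n`.
    let x : ℕ → Ordinal.{w} := fun n =>
      Nat.rec (a + 1 : Ordinal.{w}) (fun _ y => max (g y) (y + 1)) n
    have hx : ∀ n, x n < (Order.succ lam).ord := by
      intro n
      induction n with
      | zero => exact hκ.add_one_lt a.2
      | succ n ih => exact max_lt (hg _ ih) (hκ.add_one_lt ih)
    have hxs : ∀ n, x n < x (n + 1) := fun n => (lt_add_one (x n)).trans_le (le_max_right _ _)
    have hsup : ⨆ n, x n < (Order.succ lam).ord := by
      refine Ordinal.lift_iSup_lt_of_lt_cof ?_ hx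
      rw [Ordinal.lift_id'.{0, w}, (Cardinal.isRegular_succ hlam).cof_ord, Cardinal.mk_nat,
        Cardinal.lift_aleph0]
      exact Order.lt_succ_iff.2 hlam
    have hlt : ∀ β < ⨆ n, x n, ∃ n, β < x n := fun β hβ => (Ordinal.lt_iSup_iff).1 hβ
    have hle : ∀ n, x n < ⨆ n, x n := fun n =>
      (hxs n).trans_le (Ordinal.le_iSup x (n + 1))
    refine ⟨⟨⨆ n, x n, hsup⟩, ⟨isSuccLimit_of_forall_lt ?_ fun β hβ => ?_, fun β hβ => ?_⟩, ?_⟩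
    · exact (bot_le (a := x 0)).trans_lt (hle 0)
    · obtain ⟨n, hn⟩ := hlt β hβ
      exact (Order.add_one_le_of_lt hn).trans_lt (hle n)
    · obtain ⟨n, hn⟩ := hlt β hβ
      refine ⟨g (x n), (le_max_left _ _).trans_lt (hle (n + 1)), ?_⟩
      exact hanti _ _ _ hn.le (hx n) (hgQ _ (hx n))
    · exact (lt_add_one (a : Ordinal.{w})).le.trans (hle 0).le

/-- The cofinality condition under which two clubs in `lam⁺` intersect in a club. -/
theorem cof_Iio_ord_succ_ne_aleph0 {lam : Cardinal.{w}} (hlam : Cardinal.aleph0 ≤ lam) :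
    Order.cof (Set.Iio (Order.succ lam).ord) ≠ Cardinal.aleph0 := by
  rw [Ordinal.cof_Iio, ← Ordinal.lift_cof, (Cardinal.isRegular_succ hlam).cof_ord]
  refine ne_of_gt ?_
  rw [← Cardinal.lift_aleph0.{w + 1, w}, Cardinal.lift_lt]
  exact Order.lt_succ_iff.2 hlam

/-! ### Model-homogeneity of saturated models -/

namespace AEC

variable {L : FirstOrder.Language.{u, v}} {K : AEC.{u, v, w} L}

namespace PartialEmb

variable {N : Type w} [L.Structure N] {U : Type w} {lam : Cardinal.{w}}

theorem IsUnion.memCard (hlam : Cardinal.aleph0 ≤ lam) {δ : Ordinal.{w}} (hδ0 : 0 < δ)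
    (hδ : δ < (Order.succ lam).ord) {S : Ordinal.{w} → K.PartialEmb N U} {t : K.PartialEmb N U}
    (h : IsUnion δ S t)
    (hS : ∀ α < δ, K.MemCard lam (S α).dom ∧ K.MemCard lam (S α).cod.carrier) :
    K.MemCard lam t.dom ∧ K.MemCard lam t.cod.carrier := by
  have key : ∀ {V : Type w} (Y : Ordinal.{w} → Set V) (Z : Set V),
      (∀ x, x ∈ Z ↔ ∃ α < δ, x ∈ Y α) → (∀ α < δ, Cardinal.mk (Y α) = lam) →
      Cardinal.mk Z = lam := by
    intro V Y Z hZ hY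
    have hZ' : Z = ⋃ α < δ, Y α := by
      ext x
      simp [hZ]
    apply le_antisymm
    · rw [hZ']
      exact Cardinal.mk_biUnion_le_of_le (card_le_of_lt_ord_succ hδ) hlam Y
        fun α hα => (hY α hα).le
    · rw [← hY 0 hδ0]
      exact Cardinal.mk_le_mk_of_subset fun x hx => (hZ x).2 ⟨0, hδ0, hx⟩
  exact ⟨⟨t.emb.mem_left, key (fun α => ((S α).dom : Set N)) t.dom h.1 fun α hα => (hS α hα).1.2⟩,
    t.emb.mem_right, key (fun α => (S α).cod.carrier) _ h.2 fun α hα => (hS α hα).2.2⟩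

/-- An amalgam `D` of the target of `s` and an extension `M` of its domain gives an extension of
`s` whose target is isomorphic to `D`. -/
theorem exists_extends (hU : Cardinal.mk U = Order.succ lam) (hlam : Cardinal.aleph0 ≤ lam)
    (s : K.PartialEmb N U) (hs : K.MemCard lam s.cod.carrier) {D : Type w} [L.Structure D]
    (hD : K.MemCard lam D) {M : L.Substructure N} (hM : K.Strong M) (hle : K.Le s.dom M)
    (f : K.Emb M D) (g : K.Emb s.cod.carrier D)
    (hfg : ∀ n, f.map (hle.emb.map n) = g.map (s.emb.map n)) :
    ∃ (Y : SubsetModel L U) (hY : K.MemCard lam Y.carrier) (e : D ≃[L] Y.carrier),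
      (∀ x, (e (g.map x) : U) = x) ∧
      s.Extends ⟨M, hM, Y, (Emb.ofEquiv e hY.1).comp f⟩ := by
  obtain ⟨Y, e, he⟩ := SubsetModel.exists_equiv_of_extension (L := L)
    (by rw [hU]; exact hlam.trans (Order.le_succ lam)) s.cod
    (by rw [hU, hs.2]; exact Order.lt_succ lam)
    (by rw [hU, hD.2]; exact Order.le_succ lam) g.map g.injective
  refine ⟨Y, hD.of_equiv e, e, he, hle.1, ⟨(Emb.ofEquiv e (hD.of_equiv e).1).comp g, he⟩, ?_⟩
  intro n h h'
  rw [← he]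
  exact congrArg (fun d => (e d : U)) (hfg ⟨n, h⟩).symm

end PartialEmb

open PartialEmb in
/-- Saturated models are model-homogeneous. -/
theorem IsSaturated.exists_emb {lam : Cardinal.{w}} {s : PreFrame K lam}
    (hlam : Cardinal.aleph0 ≤ lam) (hAP : s.Amalgamation) {N : Type w} [L.Structure N]
    (hsat : K.IsSaturated lam N) {A : L.Substructure N} (hA : K.Strong A)
    (hAc : K.MemCard lam A) {C : Type w} [L.Structure C] (hC : K.MemCard lam C)
    (j : K.Emb A C) : ∃ f : K.Emb C N, ∀ a, f.map (j.map a) = a := by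
  obtain ⟨code, hcode, hcodelt⟩ := exists_code (V := N) hsat.1.2.le
  have hκ := isSuccLimit_ord_succ hlam
  obtain ⟨i⟩ : Cardinal.mk C ≤ Cardinal.mk N := by
    rw [hC.2, hsat.1.2]
    exact Order.le_succ lam
  obtain ⟨Y, e, -⟩ := SubsetModel.exists_equiv_of_injective (L := L) i.injective
  have hY := hC.of_equiv e
  -- The second `N` is only a set of size `lam⁺` supplying carriers; the target starts as a copy of
  -- `C` and grows while its points are pulled back into `N`.
  let x₀ : K.PartialEmb N N := ⟨A, hA, Y, (Emb.ofEquiv e hY.1).comp j⟩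
  obtain ⟨S, hS0, hSle, hSInv, hSstep, hSlim⟩ := exists_continuous_chain
    (T := K.PartialEmb N N) Extends extends_refl extends_trans (Order.succ lam).ord
    (fun s => K.MemCard lam s.dom ∧ K.MemCard lam s.cod.carrier)
    (fun α s t => ∀ x ∈ s.cod.carrier, code x = α → ∃ n, (t.emb.map n : N) = x)
    IsUnion IsUnion.congr x₀ ⟨hAc, hY⟩ (by
      rintro α - s ⟨hs, hs'⟩
      -- Stage `α` handles the target point coded by `α`: a realization of its type is adjoined to
      -- the domain, and an amalgam identifies the two. Points of `C` are in the target from the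
      -- start, so none is missed.
      by_cases hx : ∃ x ∈ s.cod.carrier, code x = α
      · obtain ⟨x, hx, hxα⟩ := hx
        obtain ⟨hs1, hfull⟩ := hsat.2 s.dom hs s.strong (by
          intro htop
          have := hs.2
          rw [htop, Cardinal.mk_congr
            (FirstOrder.Language.Substructure.topEquiv (L := L) (M := N)).toEquiv,
            hsat.1.2] at this
          exact (Order.lt_succ lam).ne' this)
        obtain ⟨b, hb⟩ := hfull (tp s.emb ⟨x, hx⟩)
        obtain ⟨M, hM, hMc, hle, hmem⟩ := exists_emb_of_LST hlam ‹PreFrame K lam›.lst_le hs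
          (Strong.emb s.strong) (fun _ : PUnit.{w + 1} => b) (by
            rw [Cardinal.mk_punit]
            exact Cardinal.one_le_aleph0.trans hlam)
        rw [Strong.range_emb] at hle
        have hle' : K.Le s.dom M := le_of_strong hle s.strong hM
        have htp : tp hle'.emb ⟨b, hmem ⟨⟩⟩ = tp s.emb ⟨x, hx⟩ := by
          rw [← hb]
          exact tp_eq_of_emb (Strong.emb hM) (fun _ => rfl) rfl
        obtain ⟨D, _, f, g, hD, h1, h2⟩ := hAP.exists_of_tp_eq hlam hs hMc hs' htp
        obtain ⟨Y, hY, e, he, hext⟩ := exists_extends hsat.1.2 hlam s hs' hD hM hle' f g h1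
        refine ⟨_, hext, ⟨hMc, hY⟩, fun y hy hyα => ?_⟩
        obtain rfl : y = x := hcode (hyα.trans hxα.symm)
        exact ⟨⟨b, hmem ⟨⟩⟩, (congrArg (fun d => (e d : N)) h2).trans (he _)⟩
      · exact ⟨s, extends_refl s, ⟨hs, hs'⟩, fun x h h' => absurd ⟨x, h, h'⟩ hx⟩) (by
      intro δ hδ hlim f _ hf hInv hcont
      obtain ⟨t, ht, htU⟩ := exists_isUnion hsat.1.1 hlim f hf hcont
      exact ⟨t, ht, htU.memCard hlam hlim.bot_lt hδ hInv, htU⟩)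
  obtain ⟨t, ht, htU⟩ := exists_isUnion hsat.1.1 hκ S hSle hSlim
  have h0 := ht 0 hκ.bot_lt
  rw [hS0] at h0
  obtain ⟨J, hJ, hJe⟩ := h0.exists_emb
  -- Each point of the copy of `C` is a value of `t.emb`, so the copy pulls back into the domain,
  -- which lies in `N`.
  obtain ⟨k, hk⟩ := Emb.exists_lift (J.comp (Emb.ofEquiv e hY.1)) t.emb (by
    rintro _ ⟨c, rfl⟩
    have hα := hcodelt (e c)
    have hc : (e c : N) ∈ (S (code (e c))).cod.carrier := by
      have := (hSle 0 _ bot_le hα).cod_subset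
      rw [hS0] at this
      exact this (e c).2
    have hα' := hκ.add_one_lt hα
    obtain ⟨n, hn⟩ := hSstep _ hα' _ hc rfl
    refine ⟨⟨n, (ht _ hα').1 n.2⟩, Subtype.ext ?_⟩
    exact ((ht _ hα').2.2 n n.2 _).symm.trans (hn.trans (hJ _).symm))
  refine ⟨(Strong.emb t.strong).comp k, fun a => ?_⟩
  have : k.map (j.map a) = h0.le.emb.map a := t.emb.injective ((hk _).trans (hJe a))
  exact congrArg Subtype.val this

end AEC

open AEC PartialEmb

namespace AEC

variable {L : FirstOrder.Language.{u, v}} {K : AEC.{u, v, w} L} {lam : Cardinal.{w}}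

theorem Le.memCard_within {X : Type w} [L.Structure X] {A B : L.Substructure X} (h : K.Le A B)
    (hA : K.MemCard lam A) : K.MemCard lam (within A B) := by
  rw [← h.range_emb]
  exact hA.range h.emb

end AEC

/-! ### Approximations and how they grow -/

namespace PreFrame

variable {L : FirstOrder.Language.{u, v}} {K : AEC.{u, v, w} L} {lam : Cardinal.{w}}
variable {N : Type w} [L.Structure N] {U : Type w}

/-- `s` is an approximation, of size `lam`, to an extension of `N` by a point `b` whose type over
`N` does not fork over `A₀`. -/
def IsApprox (fr : PreFrame K lam) (A₀ : L.Substructure N) (b : U) (s : K.PartialEmb N U) : Prop :=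
  K.MemCard lam s.dom ∧ K.MemCard lam s.cod.carrier ∧
    ∃ (h : K.Le A₀ s.dom) (hb : b ∈ s.cod.carrier), fr.NonforkingOver h.emb (tp s.emb ⟨b, hb⟩)

variable {fr : PreFrame K lam} {A₀ : L.Substructure N} {b : U} {s : K.PartialEmb N U}

theorem IsApprox.notMem_range (h : fr.IsApprox A₀ b s) (hb : b ∈ s.cod.carrier) :
    (⟨b, hb⟩ : s.cod.carrier) ∉ s.emb.range := by
  obtain ⟨-, -, _, _, hnf⟩ := h
  exact hnf.notMem_range

theorem IsApprox.isBasicTriple (h : fr.IsApprox A₀ b s) (hb : b ∈ s.cod.carrier) :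
    fr.IsBasicTriple s.emb.range (⟨b, hb⟩ : s.cod.carrier) := by
  have hnot := h.notMem_range hb
  obtain ⟨hd, hc, _, _, hnf⟩ := h
  refine ⟨hd.range _, hc, hnot, s.emb.strong_range, ?_⟩
  exact bs_of_equiv s.emb.toRange hd hc (fun _ => rfl) hnot (hnf.mem_bs hd)

/-- Unions of approximations are approximations, by continuity. -/
theorem IsApprox.of_isUnion (hlam : Cardinal.aleph0 ≤ lam) (hcont : fr.Continuity)
    {δ : Ordinal.{w}} (hδ : δ < (Order.succ lam).ord) (hlim : Order.IsSuccLimit δ)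
    {S : Ordinal.{w} → K.PartialEmb N U} (hS0 : (S 0).dom = A₀)
    (hSle : ∀ α β, α ≤ β → β < δ → (S α).Extends (S β))
    (hSlim : ∀ γ < δ, Order.IsSuccLimit γ → IsUnion γ S (S γ))
    (hS : ∀ α < δ, fr.IsApprox A₀ b (S α)) {t : K.PartialEmb N U}
    (ht : ∀ α < δ, (S α).Extends t) (htU : IsUnion δ S t) : fr.IsApprox A₀ b t := by
  obtain ⟨hdom, hcod⟩ := htU.memCard hlam hlim.bot_lt hδ fun α hα => ⟨(hS α hα).1, (hS α hα).2.1⟩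
  have hle : K.Le A₀ t.dom := by
    rw [← hS0]
    exact (ht 0 hlim.bot_lt).le
  have hb : b ∈ t.cod.carrier := by
    obtain ⟨-, -, -, hb, -⟩ := hS 0 hlim.bot_lt
    exact (ht 0 hlim.bot_lt).cod_subset hb
  refine ⟨hdom, hcod, hle, hb, ?_⟩
  have hst : ∀ α < δ, K.Strong (within (S α).dom t.dom) := fun α hα => (ht α hα).le.2
  -- Continuity is applied to the domains viewed inside their union; the remaining goal identifies
  -- the restrictions of the type with those given at the stages.
  have := (hcont δ hlim hδ t.dom (fun α => within (S α).dom t.dom) hdom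
    (fun α hα => (ht α hα).le.memCard_within (hS α hα).1)
    (fun α β hαβ hβ => le_of_strong (fun x hx => (hSle α β hαβ hβ).1 hx)
      (hst α (hαβ.trans_lt hβ)) (hst β hβ)) hst
    (fun γ hγ hγlim x => (hSlim γ hγ hγlim).1 x) (fun x => (htU.1 x).1 x.2)
    (tp t.emb ⟨b, hb⟩) ?_).2
  · unfold NonforkingOver
    rw [hle.range_emb, ← hS0]
    exact this
  · intro α hα
    obtain ⟨hdα, hcα, hleα, hbα, hnf⟩ := hS α hα
    obtain ⟨J, hJ, hJe⟩ := (ht α hα).exists_emb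
    obtain ⟨e, he⟩ := Emb.exists_lift (Strong.emb (hst α hα)) (ht α hα).le.emb (by
      rw [Strong.range_emb, Le.range_emb])
    obtain ⟨i, hi⟩ := Emb.exists_lift hleα.emb e (by
      intro x _
      refine ⟨⟨⟨x, (ht α hα).1 x.2⟩, x.2⟩, ?_⟩
      exact (ht α hα).le.emb.injective (he _))
    have h1 : e.comp i = hleα.emb := Emb.ext hi
    have h2 : (tp t.emb ⟨b, hb⟩).restrict (Strong.emb (hst α hα)) =
        (tp (S α).emb ⟨b, hbα⟩).restrict e := by
      refine (tp_eq_of_emb J (fun x => ?_) (Subtype.ext (hJ _))).symm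
      rw [Emb.comp_apply, hJe, he]
      rfl
    rw [h2]
    rw [← h1] at hnf
    have hA₀ : K.MemCard lam A₀ := by
      rw [← hS0]
      exact (hS 0 hlim.bot_lt).1
    have := hnf.restrict hA₀ ((ht α hα).le.memCard_within hdα)
    unfold NonforkingOver at this
    have hr : i.range = within (within (S 0).dom t.dom) (within (S α).dom t.dom) := by
      have hval : ∀ a, ((i.map a : t.dom) : N) = a := fun a => by
        have h1 := congrArg (fun x : (S α).dom => (x : N)) (hi a)
        have h2 := congrArg (fun x : t.dom => (x : N)) (he (i.map a))
        exact h2.symm.trans h1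
      ext x
      rw [hS0]
      constructor
      · rintro ⟨a, rfl⟩
        change ((i.map a : t.dom) : N) ∈ A₀
        rw [hval]
        exact a.2
      · intro hx
        exact ⟨⟨x, hx⟩, Subtype.ext (Subtype.ext (hval _))⟩
    rwa [hr] at this

/-- Amalgams in which the type of the point does not fork give larger approximations. -/
theorem IsApprox.exists_extends (hlam : Cardinal.aleph0 ≤ lam)
    (hU : Cardinal.mk U = Order.succ lam) (htrans : fr.Transitivity) (h : fr.IsApprox A₀ b s)
    (hA₀ : K.MemCard lam A₀) (hb : b ∈ s.cod.carrier)
    {D : Type w} [L.Structure D] (hD : K.MemCard lam D) {M : L.Substructure N} (hM : K.Strong M)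
    (hMc : K.MemCard lam M) (hle : K.Le s.dom M) (f : K.Emb M D) (g : K.Emb s.cod.carrier D)
    (hfg : ∀ n, f.map (hle.emb.map n) = g.map (s.emb.map n))
    (hnf : fr.NonforkingOver hle.emb (tp f (g.map ⟨b, hb⟩))) :
    ∃ (Y : SubsetModel L U) (hY : K.MemCard lam Y.carrier) (e : D ≃[L] Y.carrier),
      (∀ x, (e (g.map x) : U) = x) ∧
      s.Extends ⟨M, hM, Y, (Emb.ofEquiv e hY.1).comp f⟩ ∧
      fr.IsApprox A₀ b ⟨M, hM, Y, (Emb.ofEquiv e hY.1).comp f⟩ := by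
  obtain ⟨hd, hc, hleA, _, hnfA⟩ := h
  obtain ⟨Y, hY, e, he, hext⟩ := PartialEmb.exists_extends hU hlam s hc hD hM hle f g hfg
  have hleM : K.Le A₀ M := le_of_strong (hleA.1.trans hle.1) (hleA.strong s.strong) hM
  refine ⟨Y, hY, e, he, hext, hMc, hY, hleM, hext.cod_subset hb, ?_⟩
  have h1 : tp ((Emb.ofEquiv e hY.1).comp f) ⟨b, hext.cod_subset hb⟩ = tp f (g.map ⟨b, hb⟩) :=
    (tp_eq_of_emb (Emb.ofEquiv e hY.1) (fun _ => rfl) (Subtype.ext (he _))).symm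
  have h2 : fr.NonforkingOver (hle.emb.comp hleA.emb) (tp f (g.map ⟨b, hb⟩)) := by
    -- Non-forking over the old domain combines by transitivity with the old non-forking over `A₀`.
    refine hnf.trans htrans hA₀ hd hMc ?_
    convert hnfA using 1
    exact (tp_eq_of_emb g (fun n => (hfg n).symm) rfl).symm
  exact h1 ▸ h2

/-- The extension axiom supplies an amalgam of the target with `M` in which the type of `b` over `M`
does not fork over the old domain. -/
theorem IsApprox.exists_extends_dom (hlam : Cardinal.aleph0 ≤ lam)
    (hU : Cardinal.mk U = Order.succ lam) (hAP : fr.Amalgamation) (htrans : fr.Transitivity)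
    (hext : fr.Extension) (h : fr.IsApprox A₀ b s) (hA₀ : K.MemCard lam A₀)
    {M : L.Substructure N} (hM : K.Strong M) (hMc : K.MemCard lam M) (hle : s.dom ≤ M) :
    ∃ t : K.PartialEmb N U, s.Extends t ∧ fr.IsApprox A₀ b t ∧ t.dom = M := by
  have hle' : K.Le s.dom M := le_of_strong hle s.strong hM
  have h' := h
  obtain ⟨hd, hc, hleA, hb, hnf⟩ := h'
  obtain ⟨D, _, f, k, hD, hfk, hnf'⟩ := hext.exists_amalgam hlam hAP hd hc hnf.notMem_range
    (hnf.mem_bs hd) hle'.emb hMc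
  obtain ⟨Y, hY, e, he, h1, h2⟩ := h.exists_extends hlam hU htrans hA₀ hb hD hM hMc hle' f k hfk hnf'
  exact ⟨_, h1, h2, rfl⟩

variable {Nt : Type w} [L.Structure Nt]

/-- `h` is an embedding of the target of `s` over the domain of `s`. -/
def IsOver (i : K.Emb N Nt) (s : K.PartialEmb N U) (h : K.Emb s.cod.carrier Nt) : Prop :=
  ∀ n, h.map (s.emb.map n) = i.map n

/-- If the triple given by an approximation is not a uniqueness triple, then an embedding of it over
`N` can be prevented from extending to some larger approximation. -/
theorem IsApprox.exists_extends_of_not_uniqueness (hlam : Cardinal.aleph0 ≤ lam)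
    (hU : Cardinal.mk U = Order.succ lam) (hAP : fr.Amalgamation) (htrans : fr.Transitivity)
    (hsat : K.IsSaturated lam N) (h : fr.IsApprox A₀ b s) (hA₀ : K.MemCard lam A₀)
    (hb : b ∈ s.cod.carrier)
    (hnu : ¬ fr.IsUniquenessTriple s.emb.range (⟨b, hb⟩ : s.cod.carrier))
    (i : K.Emb N Nt) (k : K.Emb s.cod.carrier Nt) :
    ∃ t : K.PartialEmb N U, s.Extends t ∧ fr.IsApprox A₀ b t ∧
      ¬ ∃ k' : K.Emb t.cod.carrier Nt, IsOver i t k' ∧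
        ∀ x (hx : x ∈ s.cod.carrier) (hx' : x ∈ t.cod.carrier), k'.map ⟨x, hx'⟩ = k.map ⟨x, hx⟩ := by
  unfold IsUniquenessTriple at hnu
  push Not at hnu
  obtain ⟨hA, C, _, j, hC, -, D, _, F, _, fB, fC, gB, gC, hD, hF, hf, hg, hne, htp, hnf⟩ :=
    hnu (h.isBasicTriple hb)
  have hd := h.1
  let j' : K.Emb s.dom C := j.comp (Emb.ofEquiv s.emb.toRange j.mem_left)
  have hj' : j'.range = j.range := by
    ext x
    constructor
    · rintro ⟨a, rfl⟩
      exact ⟨_, rfl⟩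
    · rintro ⟨a, rfl⟩
      exact ⟨s.emb.toRange.symm a, congrArg j.map (s.emb.toRange.apply_symm_apply a)⟩
  -- Saturation puts the extension `C` of the domain inside `N`, so its image can be the next
  -- domain.
  obtain ⟨fN, hfN⟩ := hsat.exists_emb hlam hAP s.strong hd hC j'
  have hMc : K.MemCard lam fN.range := hC.range fN
  have hle : K.Le s.dom fN.range := le_of_strong (fun n hn => ⟨j'.map ⟨n, hn⟩, hfN _⟩) s.strong
    fN.strong_range
  let r : K.Emb fN.range C := Emb.ofEquiv fN.toRange.symm fN.mem_left
  have hr : ∀ n, r.map (hle.emb.map n) = j'.map n := fun n => by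
    apply fN.injective
    rw [hfN]
    exact congrArg Subtype.val (fN.toRange.apply_symm_apply (hle.emb.map n))
  have hrsurj : ∀ c, ∃ m, r.map m = c := fun c => ⟨fN.toRange c, fN.toRange.symm_apply_apply c⟩
  -- both amalgams give approximations
  have key : ∀ (E : Type w) [L.Structure E] (eB : K.Emb s.cod.carrier E) (eC : K.Emb C E),
      K.MemCard lam E → (∀ a, eB.map ((Strong.emb hA).map a) = eC.map (j.map a)) →
      fr.DoesNotFork (tp eC (eB.map ⟨b, hb⟩)) j.range →
      (∀ t : K.PartialEmb N U, s.Extends t → fr.IsApprox A₀ b t →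
        ∃ k' : K.Emb t.cod.carrier Nt, IsOver i t k' ∧
        ∀ x (hx : x ∈ s.cod.carrier) (hx' : x ∈ t.cod.carrier),
          k'.map ⟨x, hx'⟩ = k.map ⟨x, hx⟩) →
      ∃ l : K.Emb E Nt, (∀ x, l.map (eB.map x) = k.map x) ∧
        ∀ m, l.map (eC.map (r.map m)) = i.map m := by
    intro E _ eB eC hE heBC hnfE hall
    have hcomm : ∀ n, (eC.comp r).map (hle.emb.map n) = eB.map (s.emb.map n) := fun n => by
      rw [Emb.comp_apply, hr]
      exact (heBC (s.emb.toRange n)).symm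
    obtain ⟨Y, hY, e, he, h1, h2⟩ := h.exists_extends hlam hU htrans hA₀ hb hE fN.strong_range hMc
      hle (eC.comp r) eB hcomm (by
        refine NonforkingOver.restrict (p := tp eC (eB.map ⟨b, hb⟩)) (k := r) ?_ hd hMc
        rw [show r.comp hle.emb = j' from Emb.ext hr]
        unfold NonforkingOver
        rw [hj']
        exact hnfE)
    obtain ⟨k', hk', hk''⟩ := hall _ h1 h2
    refine ⟨k'.comp (Emb.ofEquiv e hY.1), fun x => ?_, fun m => hk' m⟩
    rw [← hk'' x x.2 (h1.cod_subset x.2)]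
    exact congrArg k'.map (Subtype.ext (he x))
  by_contra! hall
  obtain ⟨l, hl, hl'⟩ := key D fB fC hD hf hnf hall
  obtain ⟨l', hl2, hl2'⟩ := key F gB gC hF hg (htp ▸ hnf) hall
  -- So `Nt` amalgamates `D` and `F` compatibly, which non-uniqueness forbids.
  refine hne ⟨Nt, inferInstance, l, l', fun x => (hl x).trans (hl2 x).symm, fun c => ?_⟩
  obtain ⟨m, rfl⟩ := hrsurj c
  exact (hl' m).trans (hl2' m).symm

/-- The graph of an embedding of the target of a partial embedding. -/
def graphSet (s : K.PartialEmb N U) (h : K.Emb s.cod.carrier Nt) : Set (U × Nt) :=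
  {v | ∃ hx : v.1 ∈ s.cod.carrier, h.map ⟨v.1, hx⟩ = v.2}

theorem eq_of_graphSet_eq {h h' : K.Emb s.cod.carrier Nt} (e : graphSet s h = graphSet s h') :
    h = h' := by
  refine Emb.ext fun x => ?_
  have : ((x : U), h.map x) ∈ graphSet s h' := e ▸ ⟨x.2, rfl⟩
  exact this.2.symm

/-- The successor step: absorb a point of `N` and, if the guess `G` is the graph of an embedding
over `N` of a non-uniqueness triple, prevent this embedding from extending. -/
theorem IsApprox.exists_step (hlam : Cardinal.aleph0 ≤ lam)
    (hU : Cardinal.mk U = Order.succ lam) (hAP : fr.Amalgamation) (htrans : fr.Transitivity)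
    (hext : fr.Extension) (hsat : K.IsSaturated lam N) (h : fr.IsApprox A₀ b s)
    (hA₀ : K.MemCard lam A₀) (i : K.Emb N Nt) (G : Set (U × Nt)) (n : N) :
    ∃ t : K.PartialEmb N U, s.Extends t ∧ fr.IsApprox A₀ b t ∧ n ∈ t.dom ∧
      ∀ (hb : b ∈ s.cod.carrier) (k : K.Emb s.cod.carrier Nt), graphSet s k = G →
        (∃ k' : K.Emb t.cod.carrier Nt, IsOver i t k' ∧
          ∀ x (hx : x ∈ s.cod.carrier) (hx' : x ∈ t.cod.carrier),
            k'.map ⟨x, hx'⟩ = k.map ⟨x, hx⟩) →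
        fr.IsUniquenessTriple s.emb.range (⟨b, hb⟩ : s.cod.carrier) := by
  have h1 : ∃ t : K.PartialEmb N U, s.Extends t ∧ fr.IsApprox A₀ b t ∧
      ∀ (hb : b ∈ s.cod.carrier) (k : K.Emb s.cod.carrier Nt), graphSet s k = G →
        (∃ k' : K.Emb t.cod.carrier Nt, IsOver i t k' ∧
          ∀ x (hx : x ∈ s.cod.carrier) (hx' : x ∈ t.cod.carrier),
            k'.map ⟨x, hx'⟩ = k.map ⟨x, hx⟩) →
        fr.IsUniquenessTriple s.emb.range (⟨b, hb⟩ : s.cod.carrier) := by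
    by_cases hk : ∃ (hb : b ∈ s.cod.carrier) (k : K.Emb s.cod.carrier Nt), graphSet s k = G ∧
        ¬ fr.IsUniquenessTriple s.emb.range (⟨b, hb⟩ : s.cod.carrier)
    · obtain ⟨hb, k, hkG, hnu⟩ := hk
      obtain ⟨t, ht, ht', hno⟩ := h.exists_extends_of_not_uniqueness hlam hU hAP htrans hsat hA₀ hb
        hnu i k
      refine ⟨t, ht, ht', fun _ k₁ hk₁ hex => absurd hex ?_⟩
      -- The guess determines the embedding, so blocking the chosen `k` blocks every `k₁` with that
      -- graph.
      rwa [eq_of_graphSet_eq (hk₁.trans hkG.symm)]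
    · push Not at hk
      exact ⟨s, extends_refl s, h, fun hb k hkG _ => hk hb k hkG⟩
  obtain ⟨t, ht, htA, htk⟩ := h1
  obtain ⟨M, hM, hMc, hle, hmem⟩ := exists_emb_of_LST hlam fr.lst_le htA.1
    (Strong.emb t.strong) (fun _ : PUnit.{w + 1} => n) (by
      rw [Cardinal.mk_punit]
      exact Cardinal.one_le_aleph0.trans hlam)
  rw [Strong.range_emb] at hle
  obtain ⟨t', ht', htA', hdom⟩ := htA.exists_extends_dom hlam hU hAP htrans hext hA₀ hM hMc hle
  refine ⟨t', extends_trans _ _ _ ht ht', htA', by rw [hdom]; exact hmem ⟨⟩, ?_⟩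
  rintro hb k hkG ⟨k', hk', hk''⟩
  obtain ⟨J, hJ, hJe⟩ := ht'.exists_emb
  -- Enlarging `t` to absorb `n` keeps the obstruction: an embedding of the larger target restricts
  -- to `t`.
  refine htk hb k hkG ⟨k'.comp J, fun n => ?_, fun x hx hx' => ?_⟩
  · rw [Emb.comp_apply, hJe]
    exact hk' _
  · rw [← hk'' x hx (ht'.cod_subset hx')]
    exact congrArg k'.map (Subtype.ext (hJ _))

end PreFrame

/-! ### Transport of triples and coding of embeddings -/

namespace PreFrame

variable {L : FirstOrder.Language.{u, v}} {K : AEC.{u, v, w} L} {lam : Cardinal.{w}}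
variable {fr : PreFrame K lam}
variable {X X' : Type w} [L.Structure X] [L.Structure X']

theorem eq_range_of_equiv {A : L.Substructure X} {A' : L.Substructure X'} (φ : X ≃[L] X')
    (hX' : K.Mem X') (hA : K.Strong A) (hA' : ∀ x, φ x ∈ A' ↔ x ∈ A) :
    A' = ((Emb.ofEquiv φ hX').comp (Strong.emb hA)).range := by
  ext x
  constructor
  · intro hx
    have hx' : φ (φ.symm x) = x := φ.apply_symm_apply x
    exact ⟨⟨φ.symm x, (hA' _).1 (hx'.symm ▸ hx)⟩, hx'⟩
  · rintro ⟨a, rfl⟩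
    exact (hA' a).2 a.2

theorem IsBasicTriple.of_equiv {A : L.Substructure X} {b : X} (h : fr.IsBasicTriple A b)
    (φ : X ≃[L] X') {A' : L.Substructure X'} (hA' : ∀ x, φ x ∈ A' ↔ x ∈ A) :
    fr.IsBasicTriple A' (φ b) := by
  obtain ⟨h1, h2, h3, hA, h4⟩ := h
  have hX' := h2.of_equiv φ
  obtain rfl := eq_range_of_equiv φ hX'.1 hA hA'
  refine ⟨h1.range _, hX', fun h => h3 ((hA' b).1 h), Emb.strong_range _, ?_⟩
  exact fr.bs_iso _ _ (Emb.toRange _) φ b h1 h2 (fun _ => rfl) (by rwa [Strong.range_emb]) h4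

/-- A witness of non-uniqueness for the image pulls back along `φ` with the same `C`, `D` and `F`;
only the maps out of the two transported models change. -/
theorem IsUniquenessTriple.of_equiv {A : L.Substructure X} {b : X} (h : fr.IsUniquenessTriple A b)
    (φ : X ≃[L] X') {A' : L.Substructure X'} (hA' : ∀ x, φ x ∈ A' ↔ x ∈ A) :
    fr.IsUniquenessTriple A' (φ b) := by
  refine ⟨h.1.of_equiv φ hA', ?_⟩
  obtain ⟨⟨h1, h2, h3, hA, h4⟩, huniq⟩ := h
  have hX' := h2.of_equiv φ
  obtain rfl := eq_range_of_equiv φ hX'.1 hA hA'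
  rintro hs C _ j ⟨hC, hj, D, _, F, _, fB, fC, gB, gC, hD, hF, hf, hg, hne, htp, hnf⟩
  let ψ := ((Emb.ofEquiv φ hX'.1).comp (Strong.emb hA)).toRange
  let j' : K.Emb A C := j.comp (Emb.ofEquiv ψ j.mem_left)
  have hj' : j'.range = j.range := by
    ext x
    constructor
    · rintro ⟨a, rfl⟩
      exact ⟨_, rfl⟩
    · rintro ⟨a, rfl⟩
      exact ⟨ψ.symm a, congrArg j.map (ψ.apply_symm_apply a)⟩
  refine huniq hA C j' ⟨hC, by rwa [hj'], D, _, F, _, fB.comp (Emb.ofEquiv φ hX'.1), fC,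
    gB.comp (Emb.ofEquiv φ hX'.1), gC, hD, hF, fun a => hf (ψ a), fun a => hg (ψ a), ?_, htp, ?_⟩
  · rintro ⟨G, _, k, l, hkl, hkl'⟩
    refine hne ⟨G, _, k, l, fun x => ?_, hkl'⟩
    have := hkl (φ.symm x)
    simpa only [Emb.comp_apply, Emb.ofEquiv_apply, φ.apply_symm_apply] using this
  · rw [hj']
    exact hnf

variable {N : Type w} [L.Structure N] {U : Type w}

section

variable {Nt : Type w} [L.Structure Nt]

theorem mem_within_range_iff {s : K.PartialEmb N U} (k : K.Emb s.cod.carrier Nt)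
    {C : L.Substructure Nt} (hC : ∀ x, x ∈ C ↔ ∃ n, k.map (s.emb.map n) = x) (x : s.cod.carrier) :
    k.toRange x ∈ within C k.range ↔ x ∈ s.emb.range := by
  refine (hC (k.map x)).trans (exists_congr fun n => ?_)
  exact k.injective.eq_iff

theorem isBasicTriple_image {s : K.PartialEmb N U} {b : s.cod.carrier}
    (h : fr.IsBasicTriple s.emb.range b) (k : K.Emb s.cod.carrier Nt) {C D : L.Substructure Nt}
    (hC : ∀ x, x ∈ C ↔ ∃ n, k.map (s.emb.map n) = x) (hD : D = k.range) {d : Nt}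
    (hd : k.map b = d) : ∃ h : d ∈ D, fr.IsBasicTriple (within C D) ⟨d, h⟩ := by
  subst hD hd
  exact ⟨⟨b, rfl⟩, h.of_equiv k.toRange (mem_within_range_iff k hC)⟩

theorem isUniquenessTriple_image {s : K.PartialEmb N U} {b : s.cod.carrier}
    (h : fr.IsUniquenessTriple s.emb.range b) (k : K.Emb s.cod.carrier Nt)
    {C D : L.Substructure Nt} (hC : ∀ x, x ∈ C ↔ ∃ n, k.map (s.emb.map n) = x) (hD : D = k.range)
    {d : Nt} (hd : k.map b = d) : ∃ h : d ∈ D, fr.IsUniquenessTriple (within C D) ⟨d, h⟩ := by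
  subst hD hd
  exact ⟨⟨b, rfl⟩, h.of_equiv k.toRange (mem_within_range_iff k hC)⟩

end

/-- The restrictions of a map on the union of a chain are, at club many stages, coded by the
initial segments of its code. -/
theorem isClub_coded {Nt : Type w} (hlam : Cardinal.aleph0 ≤ lam) {S : Ordinal.{w} → K.PartialEmb N U}
    {t : K.PartialEmb N U}
    (hSle : ∀ α β, α ≤ β → β < (Order.succ lam).ord → (S α).Extends (S β))
    (hSlim : ∀ δ < (Order.succ lam).ord, Order.IsSuccLimit δ → IsUnion δ S (S δ))
    (hScard : ∀ α < (Order.succ lam).ord, K.MemCard lam (S α).cod.carrier)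
    (htS : IsUnion (Order.succ lam).ord S t) (h : t.cod.carrier → Nt)
    {e : U × Nt → Ordinal.{w}} (he : Function.Injective e)
    (helt : ∀ v, e v < (Order.succ lam).ord) :
    ∃ E : Set (Set.Iio (Order.succ lam).ord), IsClub E ∧ ∀ δ ∈ E,
      {v : U × Nt | e v ∈ {o | ∃ y : t.cod.carrier, o = e (y, h y)} ∩ Set.Iio (δ : Ordinal.{w})} =
      {v | v.1 ∈ (S δ).cod.carrier ∧ ∃ hv : v.1 ∈ t.cod.carrier, h ⟨v.1, hv⟩ = v.2} := by
  -- At a closure point both directions balance: pairs of the graph over earlier stages have earlier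
  -- codes, and earlier codes belong to pairs over earlier stages.
  let Q : Ordinal.{w} → Ordinal.{w} → Prop := fun β γ =>
    (∀ y : t.cod.carrier, (y : U) ∈ (S β).cod.carrier → e (y, h y) < γ) ∧
      ∀ y : t.cod.carrier, e (y, h y) < β → (y : U) ∈ (S γ).cod.carrier
  have hQ : ∀ β < (Order.succ lam).ord, ∃ γ < (Order.succ lam).ord, Q β γ := by
    intro β hβ
    obtain ⟨γ₁, hγ₁, h1⟩ := exists_bound hlam (hScard β hβ).2.le
      (f := fun x => e (x, h ⟨x, (htS.2 x).2 ⟨β, hβ, x.2⟩⟩)) fun x => helt _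
    have hsmall : Cardinal.mk {y : t.cod.carrier // e (y, h y) < β} ≤ lam := by
      refine le_trans ?_ (card_le_of_lt_ord_succ hβ)
      rw [← Cardinal.mk_toType]
      refine Cardinal.mk_le_of_injective
        (f := fun y => Ordinal.ToType.mk (⟨e (y.1, h y.1), y.2⟩ : Set.Iio β)) fun y y' hyy => ?_
      have := he (congrArg Subtype.val (Ordinal.ToType.mk.injective hyy))
      exact Subtype.ext (Subtype.ext (congrArg Prod.fst this))
    choose f hf hfS using fun y : t.cod.carrier => (htS.2 y).1 y.2
    obtain ⟨γ₂, hγ₂, h2⟩ := exists_bound hlam hsmall (f := fun y => f y.1) fun y => hf _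
    refine ⟨max γ₁ γ₂, max_lt hγ₁ hγ₂, fun y hy => (h1 ⟨y, hy⟩).trans_le (le_max_left _ _),
      fun y hy => ?_⟩
    exact (hSle _ _ ((h2 ⟨y, hy⟩).le.trans (le_max_right _ _)) (max_lt hγ₁ hγ₂)).cod_subset (hfS y)
  refine ⟨_, isClub_closurePoints hlam (Q := Q) ?_ hQ, ?_⟩
  · rintro β β' γ hββ' hβ' ⟨h1, h2⟩
    exact ⟨fun y hy => h1 y ((hSle β β' hββ' hβ').cod_subset hy),
      fun y hy => h2 y (hy.trans_le hββ')⟩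
  · rintro δ ⟨hlim, hδ⟩
    ext ⟨x, n⟩
    constructor
    · rintro ⟨⟨y, hy⟩, hlt⟩
      obtain ⟨rfl, rfl⟩ := Prod.mk.inj (he hy)
      -- `Q β` concerns codes strictly below `β`, so it is used at the successor of the code, still
      -- below the limit `δ`.
      obtain ⟨γ, hγ, -, h2⟩ := hδ _ (hlim.add_one_lt hlt)
      exact ⟨(hSle γ δ hγ.le δ.2).cod_subset (h2 y (lt_add_one _)), y.2, rfl⟩
    · rintro ⟨hx, hx', hn⟩
      obtain ⟨β, hβ, hxβ⟩ := ((hSlim δ δ.2 hlim).2 x).1 hx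
      obtain ⟨γ, hγ, h1, -⟩ := hδ β hβ
      have hn' : (x, n) = (x, h ⟨x, hx'⟩) := Prod.ext rfl hn.symm
      rw [hn']
      exact ⟨⟨⟨x, hx'⟩, rfl⟩, (h1 ⟨x, hx'⟩ hxβ).trans hγ⟩

end PreFrame

/-! ### The main construction -/

open PreFrame

theorem corollary15p1 {L : FirstOrder.Language.{u, v}} (K : AEC.{u, v, w} L)
    (lam : Cardinal.{w}) (hlam : Cardinal.aleph0 ≤ lam) (hdiamond : Diamond (Order.succ lam))
    (s : PreFrame K lam) (hAP : s.Amalgamation) (htrans : s.Transitivity)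
    (hext : s.Extension) (hcont : s.Continuity)
    -- `Nt` is the larger model `N^∙` and `Nc` its submodel `N^∘`
    (Nt : Type w) [L.Structure Nt] (Nc : L.Substructure Nt)
    (hsat : K.IsSaturated lam Nc)
    (huniv : K.IsUniversalOver (Order.succ lam) Nc)
    (p : K.GType Nc) (hp : p ∈ s.bigBs Nc) :
    ∃ (N' : L.Substructure Nt) (hle : K.Le Nc N') (d : Nt) (hd : d ∈ N')
      (C D : Ordinal.{w} → L.Substructure Nt)
      (hC0 : K.Le (C 0) Nc) (hC0' : K.Le (C 0) N'),
      K.MemCard (Order.succ lam) N' ∧ Nc ≠ N' ∧ K.Strong N' ∧ d ∉ Nc ∧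
      K.IsRepresentation lam Nc C ∧ K.IsRepresentation lam N' D ∧
      p.restrict hC0.emb = AEC.tp hC0'.emb ⟨d, hd⟩ ∧
      s.BigDoesNotFork p (within (C 0) Nc) ∧
      s.BigDoesNotFork (AEC.tp hle.emb ⟨d, hd⟩) (within (C 0) Nc) ∧
      (∀ α < (Order.succ lam).ord, C α ≤ D α ∧
        ∃ h : d ∈ D α, s.IsBasicTriple (within (C α) (D α)) ⟨d, h⟩) ∧
      IsStationary {α : Set.Iio (Order.succ lam).ord |
        ∃ h : d ∈ D α, s.IsUniquenessTriple (within (C α) (D α)) ⟨d, h⟩} := by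
  have hκ := isSuccLimit_ord_succ hlam
  have hκinf : Cardinal.aleph0 ≤ Order.succ lam := hlam.trans (Order.le_succ lam)
  obtain ⟨hNc, hNt, hNcs, -, huniv⟩ := huniv
  obtain ⟨G, -, hG⟩ := hdiamond
  obtain ⟨A₀, hpA₀⟩ := hp
  obtain ⟨hA₀, hA₀s, hpnf⟩ := id hpA₀
  -- codes
  obtain ⟨dec, hdec⟩ : ∃ dec : Ordinal.{w} → Nc, ∀ n, ∃ α < (Order.succ lam).ord, dec α = n := by
    obtain ⟨code, hcode, hcodelt⟩ := exists_code (V := Nc) hNc.2.le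
    have : Nonempty Nc := by
      rw [← Cardinal.mk_ne_zero_iff, hNc.2]
      exact (Cardinal.aleph0_pos.trans_le hκinf).ne'
    exact ⟨Function.invFun code, fun n => ⟨code n, hcodelt n, Function.leftInverse_invFun hcode n⟩⟩
  -- In these pairs the first `Nt` is a bare set holding the carriers of the targets; the second is
  -- the model into which they are embedded.
  obtain ⟨e, he, helt⟩ := exists_code (κ := Order.succ lam) (V := Nt × Nt) (by
    rw [Cardinal.mk_prod, Cardinal.lift_id, hNt.2, Cardinal.mul_eq_self hκinf])
  let i : K.Emb Nc Nt := Strong.emb hNcs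
  -- the first approximation
  have hlerefl : K.Le A₀ A₀ := le_of_strong le_rfl hA₀s hA₀s
  have hnf₀ : s.NonforkingOver hlerefl.emb (p.restrict (Strong.emb hA₀s)) := by
    unfold NonforkingOver
    rw [hlerefl.range_emb]
    exact hpnf A₀ hA₀s hA₀ hlerefl
  obtain ⟨B₀, _, f₀, c₀, hB₀, hp₀, -⟩ := hnf₀.exists_tp
  obtain ⟨ι⟩ : Cardinal.mk B₀ ≤ Cardinal.mk Nt := by
    rw [hB₀.2, hNt.2]
    exact Order.le_succ lam
  obtain ⟨Y, e₀, -⟩ := SubsetModel.exists_equiv_of_injective (L := L) ι.injective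
  have hY := hB₀.of_equiv e₀
  let x₀ : K.PartialEmb Nc Nt := ⟨A₀, hA₀s, Y, (Emb.ofEquiv e₀ hY.1).comp f₀⟩
  let b : Nt := e₀ c₀
  have hx₀tp : p.restrict (Strong.emb hA₀s) = tp x₀.emb (e₀ c₀) := by
    rw [hp₀]
    exact (tp_comp f₀ c₀ (Emb.ofEquiv e₀ hY.1)).symm
  have hx₀ : s.IsApprox A₀ b x₀ := ⟨hA₀, hY, hlerefl, (e₀ c₀).2, by rw [← hx₀tp]; exact hnf₀⟩
  -- the chain of approximations
  obtain ⟨S, hS0, hSle, hSA, hSstep, hSlim⟩ := exists_continuous_chain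
    (T := K.PartialEmb Nc Nt) Extends extends_refl extends_trans (Order.succ lam).ord
    (s.IsApprox A₀ b)
    (fun α r t => dec α ∈ t.dom ∧ ∀ (hb : b ∈ r.cod.carrier) (k : K.Emb r.cod.carrier Nt),
      graphSet r k = {v | e v ∈ G α} →
        (∃ k' : K.Emb t.cod.carrier Nt, IsOver i t k' ∧
          ∀ x (hx : x ∈ r.cod.carrier) (hx' : x ∈ t.cod.carrier),
            k'.map ⟨x, hx'⟩ = k.map ⟨x, hx⟩) →
        s.IsUniquenessTriple r.emb.range (⟨b, hb⟩ : r.cod.carrier))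
    IsUnion IsUnion.congr x₀ hx₀
    (fun α _ r hr => hr.exists_step hlam hNt.2 hAP htrans hext hsat hA₀ i _ (dec α)) (by
      intro δ hδ hlim f hf0 hf hInv hcontf
      obtain ⟨t, ht, htU⟩ := exists_isUnion hsat.1.1 hlim f hf hcontf
      exact ⟨t, ht, IsApprox.of_isUnion hlam hcont hδ hlim (by rw [hf0]) hf hcontf hInv ht htU,
        htU⟩)
  obtain ⟨t, ht, htU⟩ := exists_isUnion hsat.1.1 hκ S hSle hSlim
  have hdom : ∀ n, n ∈ t.dom := by
    intro n
    obtain ⟨α, hα, rfl⟩ := hdec n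
    exact (htU.1 _).2 ⟨α + 1, hκ.add_one_lt hα, (hSstep α (hκ.add_one_lt hα)).1⟩
  -- the union embeds into `Nt`
  obtain ⟨gN, hgN⟩ : ∃ gN : K.Emb Nc t.cod.carrier, ∀ n, gN.map n = t.emb.map ⟨n, hdom n⟩ := by
    obtain ⟨k, hk⟩ := Emb.exists_lift (Emb.id hsat.1.1) (Strong.emb t.strong) (by
      rw [Strong.range_emb]
      exact fun n _ => hdom n)
    refine ⟨t.emb.comp k, fun n => congrArg t.emb.map (Subtype.ext (hk n))⟩
  -- The union contains a copy of `Nc`, and its carrier is a subset of `Nt`; both have size `lam⁺`.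
  have htc : K.MemCard (Order.succ lam) t.cod.carrier := by
    refine ⟨t.emb.mem_right, le_antisymm ?_ ?_⟩
    · rw [← hNt.2]
      exact Cardinal.mk_set_le _
    · rw [← hNc.2]
      exact Cardinal.mk_le_of_injective gN.injective
  obtain ⟨h, hh⟩ := huniv t.cod.carrier htc gN
  have hht : ∀ n : t.dom, h.map (t.emb.map n) = (n : Nc) := fun n => by
    rw [← hh, hgN]
  -- the restrictions of `h`
  have hJ : ∀ α < (Order.succ lam).ord, ∃ k : K.Emb (S α).cod.carrier Nt,
      (∀ x (hx : x ∈ (S α).cod.carrier) (hx' : x ∈ t.cod.carrier),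
        k.map ⟨x, hx⟩ = h.map ⟨x, hx'⟩) ∧ IsOver i (S α) k ∧ k.range ≤ h.range := by
    intro α hα
    obtain ⟨J, hJ, hJe⟩ := (ht α hα).exists_emb
    refine ⟨h.comp J, fun x hx hx' => congrArg h.map (Subtype.ext (hJ _)), fun n => ?_, ?_⟩
    · rw [Emb.comp_apply, hJe, hht]
      rfl
    · rintro _ ⟨x, rfl⟩
      exact ⟨J.map x, rfl⟩
  -- `D α` is the image under `h` of the target at stage `α`; values from `lam⁺` on are arbitrary.
  obtain ⟨D, hD⟩ : ∃ D : Ordinal.{w} → L.Substructure Nt, ∀ α < (Order.succ lam).ord,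
      ∃ k : K.Emb (S α).cod.carrier Nt,
        (∀ x (hx : x ∈ (S α).cod.carrier) (hx' : x ∈ t.cod.carrier),
          k.map ⟨x, hx⟩ = h.map ⟨x, hx'⟩) ∧ IsOver i (S α) k ∧ k.range ≤ h.range ∧
        D α = k.range := by
    have : ∀ α, ∃ D : L.Substructure Nt, α < (Order.succ lam).ord →
        ∃ k : K.Emb (S α).cod.carrier Nt,
          (∀ x (hx : x ∈ (S α).cod.carrier) (hx' : x ∈ t.cod.carrier),
            k.map ⟨x, hx⟩ = h.map ⟨x, hx'⟩) ∧ IsOver i (S α) k ∧ k.range ≤ h.range ∧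
          D = k.range := by
      intro α
      by_cases hα : α < (Order.succ lam).ord
      · obtain ⟨k, h1, h2, h3⟩ := hJ α hα
        exact ⟨k.range, fun _ => ⟨k, h1, h2, h3, rfl⟩⟩
      · exact ⟨⊤, fun h => absurd h hα⟩
    choose D hD using this
    exact ⟨D, hD⟩
  have hDmem : ∀ α < (Order.succ lam).ord, ∀ x, x ∈ D α ↔
      ∃ y : t.cod.carrier, (y : Nt) ∈ (S α).cod.carrier ∧ h.map y = x := by
    intro α hα x
    obtain ⟨k, hk, -, -, hkD⟩ := hD α hα
    rw [hkD]
    constructor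
    · rintro ⟨y, rfl⟩
      have hy := (ht α hα).cod_subset y.2
      exact ⟨⟨y, hy⟩, y.2, (hk y y.2 hy).symm⟩
    · rintro ⟨y, hy, rfl⟩
      exact ⟨⟨y, hy⟩, hk y hy y.2⟩
  have hDs : ∀ α < (Order.succ lam).ord, K.Strong (D α) := by
    intro α hα
    obtain ⟨k, -, -, -, hkD⟩ := hD α hα
    rw [hkD]
    exact k.strong_range
  let C : Ordinal.{w} → L.Substructure Nt := fun α => (i.comp (Strong.emb (S α).strong)).range
  have hCmem : ∀ α x, x ∈ C α ↔ ∃ n : Nc, n ∈ (S α).dom ∧ (n : Nt) = x := by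
    intro α x
    constructor
    · rintro ⟨n, rfl⟩
      exact ⟨n, n.2, rfl⟩
    · rintro ⟨n, hn, rfl⟩
      exact ⟨⟨n, hn⟩, rfl⟩
  have hCs : ∀ α, K.Strong (C α) := fun α => Emb.strong_range _
  have hCNc : ∀ α, C α ≤ Nc := by
    rintro α _ ⟨n, rfl⟩
    exact (n : Nc).2
  have hCD : ∀ α < (Order.succ lam).ord, C α ≤ D α := by
    rintro α hα _ ⟨n, rfl⟩
    obtain ⟨k, -, hk, -, hkD⟩ := hD α hα
    rw [hkD]
    exact ⟨(S α).emb.map n, hk n⟩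
  have hSmono : ∀ α β, α ≤ β → β < (Order.succ lam).ord → C α ≤ C β := by
    intro α β hαβ hβ x hx
    obtain ⟨n, hn, rfl⟩ := (hCmem α x).1 hx
    exact (hCmem β _).2 ⟨n, (hSle α β hαβ hβ).1 hn, rfl⟩
  have hNcle : Nc ≤ h.range := fun n hn => ⟨gN.map ⟨n, hn⟩, hh ⟨n, hn⟩⟩
  have hbS : ∀ α < (Order.succ lam).ord, b ∈ (S α).cod.carrier := fun α hα => by
    obtain ⟨-, -, _, hb, -⟩ := hSA α hα
    exact hb
  have hbt : b ∈ t.cod.carrier := (ht 0 hκ.bot_lt).cod_subset (hbS 0 hκ.bot_lt)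
  let d : Nt := h.map ⟨b, hbt⟩
  have hd : d ∈ h.range := ⟨_, rfl⟩
  have hdNc : d ∉ Nc := by
    intro hdn
    obtain ⟨α, hα, hn⟩ := (htU.1 ⟨d, hdn⟩).1 (hdom _)
    refine (hSA α hα).notMem_range (hbS α hα) ⟨⟨_, hn⟩, Subtype.ext ?_⟩
    refine ((ht α hα).2.2 _ hn (hdom _)).trans ?_
    exact congrArg Subtype.val (h.injective (hht ⟨⟨d, hdn⟩, hdom _⟩))
  -- the maps from the stages into `N'`
  have hT : ∀ α (hα : α < (Order.succ lam).ord), ∃ k : K.Emb (S α).cod.carrier h.range,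
      (∀ n, ((k.map ((S α).emb.map n) : h.range) : Nt) = (n : Nc)) ∧
        ((k.map ⟨b, hbS α hα⟩ : h.range) : Nt) = d := by
    intro α hα
    obtain ⟨k, hk, hki, hkr, -⟩ := hD α hα
    obtain ⟨l, hl⟩ := Emb.exists_lift k (Strong.emb h.strong_range) (by
      rwa [Strong.range_emb])
    exact ⟨l, fun n => (hl _).trans (hki n), (hl _).trans (hk b _ hbt)⟩
  have hC0 : K.Le (C 0) Nc := le_of_strong (hCNc 0) (hCs 0) hNcs
  have hC0' : K.Le (C 0) h.range := le_of_strong ((hCNc 0).trans hNcle) (hCs 0) h.strong_range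
  have hleN : K.Le Nc h.range := le_of_strong hNcle hNcs h.strong_range
  have hCA₀ : within (C 0) Nc = A₀ := by
    ext n
    refine (hCmem 0 n).trans ?_
    rw [hS0]
    constructor
    · rintro ⟨m, hm, hmn⟩
      rwa [← Subtype.ext hmn]
    · intro hn
      exact ⟨n, hn, rfl⟩
  refine ⟨h.range, hleN, d, hd, C, D, hC0, hC0', htc.range h, ?_, h.strong_range, hdNc, ?_, ?_, ?_,
    ?_, ?_, ?_, ?_⟩
  · intro heq
    exact hdNc (heq ▸ hd)
  · refine ⟨fun α hα => (hSA α hα).1.range _, fun α β hαβ hβ =>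
      le_of_strong (hSmono α β hαβ hβ) (hCs α) (hCs β), fun δ hδ hlim x => ?_, fun x => ?_⟩
    · simp only [hCmem, (hSlim δ hδ hlim).1]
      constructor
      · rintro ⟨n, ⟨α, hα, hn⟩, rfl⟩
        exact ⟨α, hα, n, hn, rfl⟩
      · rintro ⟨α, hα, n, hn, rfl⟩
        exact ⟨n, ⟨α, hα, hn⟩, rfl⟩
    · constructor
      · intro hx
        obtain ⟨α, hα, hn⟩ := (htU.1 ⟨x, hx⟩).1 (hdom _)
        exact ⟨α, hα, (hCmem α x).2 ⟨_, hn, rfl⟩⟩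
      · rintro ⟨α, -, hx⟩
        exact hCNc α hx
  · refine ⟨fun α hα => ?_, fun α β hαβ hβ =>
      le_of_strong ?_ (hDs α (hαβ.trans_lt hβ)) (hDs β hβ), fun δ hδ hlim x => ?_, fun x => ?_⟩
    · obtain ⟨k, -, -, -, hkD⟩ := hD α hα
      rw [hkD]
      exact (hSA α hα).2.1.range k
    · intro x hx
      obtain ⟨y, hy, rfl⟩ := (hDmem α (hαβ.trans_lt hβ) x).1 hx
      exact (hDmem β hβ _).2 ⟨y, (hSle α β hαβ hβ).cod_subset hy, rfl⟩
    · rw [hDmem δ hδ]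
      constructor
      · rintro ⟨y, hy, rfl⟩
        obtain ⟨α, hα, hy⟩ := ((hSlim δ hδ hlim).2 y).1 hy
        exact ⟨α, hα, (hDmem α (hα.trans hδ) _).2 ⟨y, hy, rfl⟩⟩
      · rintro ⟨α, hα, hx⟩
        obtain ⟨y, hy, rfl⟩ := (hDmem α (hα.trans hδ) x).1 hx
        exact ⟨y, ((hSlim δ hδ hlim).2 y).2 ⟨α, hα, hy⟩, rfl⟩
    · constructor
      · rintro ⟨y, rfl⟩
        obtain ⟨α, hα, hy⟩ := (htU.2 y).1 y.2
        exact ⟨α, hα, (hDmem α hα _).2 ⟨y, hy, rfl⟩⟩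
      · rintro ⟨α, hα, hx⟩
        obtain ⟨y, -, rfl⟩ := (hDmem α hα x).1 hx
        exact ⟨y, rfl⟩
  · -- the type of `d` over `C 0`
    obtain ⟨q, hq⟩ := Emb.exists_lift hC0.emb (Strong.emb hA₀s) (by
      rw [hC0.range_emb, Strong.range_emb, hCA₀])
    rw [show hC0.emb = (Strong.emb hA₀s).comp q from Emb.ext fun x => (hq x).symm,
      ← restrict_restrict, hx₀tp]
    have hext0 : x₀.Extends (S 0) := hS0 ▸ extends_refl x₀
    obtain ⟨J, hJb, hJe⟩ := hext0.exists_emb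
    obtain ⟨k, hk, hkb⟩ := hT 0 hκ.bot_lt
    refine tp_eq_of_emb (k.comp J) (fun x => Subtype.ext ?_) (Subtype.ext ?_)
    · rw [Emb.comp_apply, Emb.comp_apply, hJe, hk]
      exact congrArg (fun n : Nc => (n : Nt)) (hq x)
    · exact (congrArg (fun y => (k.map y : Nt)) (Subtype.ext (hJb _))).trans hkb
  · rw [hCA₀]
    exact hpA₀
  · -- nonforking of the type of `d`
    rw [hCA₀]
    refine ⟨hA₀, hA₀s, fun B hB hBc hAB => ?_⟩
    -- A submodel of size `lam` is swallowed by the domain of one stage, by regularity of `lam⁺`;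
    -- non-forking there restricts to it.
    choose f hf hfS using fun n : B => (htU.1 n).1 (hdom n)
    obtain ⟨γ, hγ, hfγ⟩ := exists_bound hlam hBc.2.le hf
    have hBS : K.Le B (S γ).dom := le_of_strong
      (fun n hn => (hSle _ γ (hfγ ⟨n, hn⟩).le hγ).1 (hfS ⟨n, hn⟩)) hB (S γ).strong
    obtain ⟨-, -, hAS, hb, hnf⟩ := hSA γ hγ
    have h1 : s.NonforkingOver hAB.emb ((tp (S γ).emb ⟨b, hb⟩).restrict hBS.emb) :=
      NonforkingOver.restrict (k := hBS.emb) hnf hA₀ hBc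
    unfold NonforkingOver at h1
    rw [hAB.range_emb] at h1
    convert h1 using 1
    obtain ⟨k, hk, hkb⟩ := hT γ hγ
    exact (tp_eq_of_emb k (fun x => Subtype.ext (hk _)) (Subtype.ext hkb)).symm
  · intro α hα
    refine ⟨hCD α hα, ?_⟩
    obtain ⟨k, hk, hki, -, hkD⟩ := hD α hα
    refine isBasicTriple_image ((hSA α hα).isBasicTriple (hbS α hα)) k (fun x => ?_) hkD
      (hk b _ hbt)
    exact exists_congr fun n => by rw [hki n]; rfl
  · -- stationarity
    obtain ⟨E, hE, hEδ⟩ := isClub_coded hlam hSle hSlim (fun α hα => (hSA α hα).2.1) htU h.map he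
      helt
    intro E' hE'
    -- Diamond guesses the codes of `h` at a point of the given club that also lies in `E`, where
    -- the initial segment codes exactly the restriction of `h` to stage `δ`.
    obtain ⟨δ, hδG, hδE', hδ⟩ := hG {o | ∃ y : t.cod.carrier, o = e (y, h.map y)} (by
      rintro _ ⟨y, rfl⟩
      exact helt _) (hE'.inter (cof_Iio_ord_succ_ne_aleph0 hlam) hE)
    refine ⟨δ, ?_, hδE'⟩
    obtain ⟨k, hk, hki, -, hkD⟩ := hD δ δ.2
    refine isUniquenessTriple_image (b := ⟨b, hbS δ δ.2⟩) ?_ k (fun x => ?_) hkD (hk b _ hbt)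
    · have hδ1 := hκ.add_one_lt δ.2
      refine (hSstep δ hδ1).2 (hbS δ δ.2) k ?_ ?_
      · rw [← show _ = G δ from hδG]
        refine Eq.trans ?_ (hEδ δ hδ).symm
        ext ⟨x, n⟩
        constructor
        · rintro ⟨hx, hn⟩
          have hx' := (ht δ δ.2).cod_subset hx
          exact ⟨hx, hx', (hk x hx hx').symm.trans hn⟩
        · rintro ⟨hx, hx', hn⟩
          exact ⟨hx, (hk x hx hx').trans hn⟩
      -- The restriction of `h` to stage `δ + 1` extends the guessed map over `Nc`, so the blocking
      -- alternative was not taken.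
      · obtain ⟨k', hk', hki', -, -⟩ := hD _ hδ1
        refine ⟨k', hki', fun x hx hx' => ?_⟩
        have hxt := (ht δ δ.2).cod_subset hx
        exact (hk' x hx' hxt).trans (hk x hx hxt).symm
    · exact exists_congr fun n => by rw [hki n]; rfl
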